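/- Let $\mathcal S=\mathbb R/2\mathbb Z$ be the circle of perimeter $2$, and fix $\mu\in(0,\tfrac12]$. The compass model on $\mathbb Z$ with parameter $\mu$ is the Markov process $\eta_t=(\eta_t(v))_{v\in\mathbb Z}$ on $\mathcal S^{\mathbb Z}$ (with the product topology) in which every edge $\langle v,v+1\rangle$, independently, is updated at rate $1$: at an update the opinions at $v$ and $v+1$ move towards each other along the shortest arc between them, each by the fraction $\mu$ of their distance; if the two opinions are diametrically opposed, one of the two shortest arcs is chosen with probability $\tfrac12$ each. In other words, $(\eta_t)_{t\ge0}$ has càdlàg paths and solves the martingale problem for the generator $$\mathcal Lf(\eta)=\sum_{v\in\mathbb Z}\Big(\tfrac12\big[f(A^{(1)}_{v}\eta)+f(A^{(2)}_{v}\eta)\big]-f(\eta)\Big)$$ on all continuous functions $f:\mathcal S^{\mathbb Z}\to\mathbb R$ of finitely many coordinates, where $A^{(1)}_v,A^{(2)}_v$ are the updates along the edge $\langle v,v+1\rangle$ for the two choices of arc (they agree unless $\eta(v)$ and $\eta(v+1)$ are diametrically opposed). Suppose that the initial opinions $(\eta_0(v))_{v\in\mathbb Z}$ are i.i.d. uniform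 on $\mathcal S$. Then the law of $\eta_t$ converges weakly, as $t\to\infty$, to the mixture $\tfrac12\int_{-1}^{1}\delta_{\bar s}\,ds$ of constant configurations with a uniform value, where $\bar s$ denotes the configuration that has the value $s \bmod 2$ at every vertex and $\delta_{\bar s}$ is the point mass at $\bar s$. -/

import Mathlib

open Filter Topology MeasureTheory ProbabilityTheory
open scoped NNReal

noncomputable section

namespace CompassModel

instance fact_two_pos : Fact ((0 : ℝ) < 2) := ⟨two_pos⟩

/-- The opinion space: the circle `ℝ / 2ℤ`, of perimeter `2`. -/
abbrev Opinion : Type := AddCircle (2 : ℝ)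

/-- Configurations of opinions on `ℤ`, with the product topology and product σ-algebra. -/
abbrev Config : Type := ℤ → Opinion

/-- The signed length in `(-1, 1]` of a shortest arc leading from `x` to `y`. The points are
diametrically opposed iff the value is `1`; then the arc of signed length `-1` is shortest too. -/
def arc (x y : Opinion) : ℝ := (AddCircle.equivIoc (2 : ℝ) (-1) (y - x) : ℝ)

/-- The signed length of the geodesic from `x` to `y` that is used for an update. The parameter `k`
selects one of the two geodesics if the points are diametrically opposed, and has no effect
otherwise. -/
def geodesic (k : Bool) (x y : Opinion) : ℝ :=
  if arc x y = 1 then (if k then 1 else -1) else arc x y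

/-- The update along the edge `⟨v, v + 1⟩`: both incident opinions move a fraction `μ` of their
distance towards each other along the same geodesic. -/
def update (μ : ℝ) (k : Bool) (v : ℤ) (η : Config) : Config := fun w =>
  if w = v then η v + ((μ * geodesic k (η v) (η (v + 1)) : ℝ) : Opinion)
  else if w = v + 1 then η (v + 1) - ((μ * geodesic k (η v) (η (v + 1)) : ℝ) : Opinion)
  else η w

/-- Test functions: continuous functions of finitely many coordinates. -/
def IsTestFunction (f : Config → ℝ) : Prop :=
  Continuous f ∧ ∃ Λ : Finset ℤ, DependsOn f (Λ : Set ℤ)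

/-- The generator of the compass model on `ℤ`: each edge `⟨v, v + 1⟩` is updated at rate `1`, with
a fair choice of the geodesic. For a function of finitely many coordinates only finitely many
summands are nonzero. -/
def generator (μ : ℝ) (f : Config → ℝ) (η : Config) : ℝ :=
  ∑ᶠ v : ℤ, ((1 / 2 : ℝ) * (f (update μ true v η) + f (update μ false v η)) - f η)

/-- The process `η` is a compass model on `ℤ` with parameter `μ`, i.e. the Markov process with
generator `generator μ`: it has càdlàg paths, it is adapted to `ℱ`, and it solves the martingale
problem for the generator, on all continuous functions of finitely many coordinates. -/
structure IsCompassModel (μ : ℝ) {Ω : Type*} {mΩ : MeasurableSpace Ω} (P : Measure Ω)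
    (ℱ : Filtration ℝ≥0 mΩ) (η : ℝ≥0 → Ω → Config) : Prop where
  adapted : ∀ t, Measurable[ℱ t] (η t)
  right_continuous : ∀ ω t, ContinuousWithinAt (fun s => η s ω) (Set.Ici t) t
  left_limits : ∀ ω t, 0 < t → ∃ l : Config, Tendsto (fun s => η s ω) (𝓝[<] t) (𝓝 l)
  martingale : ∀ f : Config → ℝ, IsTestFunction f →
    Martingale
      (fun (t : ℝ≥0) ω => f (η t ω) - ∫ s in (0 : ℝ)..t, generator μ f (η s.toNNReal ω)) ℱ P

theorem IsCompassModel.measurable {μ : ℝ} {Ω : Type*} {mΩ : MeasurableSpace Ω} {P : Measure Ω}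
    {ℱ : Filtration ℝ≥0 mΩ} {η : ℝ≥0 → Ω → Config} (h : IsCompassModel μ P ℱ η) (t : ℝ≥0) :
    Measurable (η t) :=
  (h.adapted t).mono (ℱ.le t) le_rfl

/-- The opinions of the random configuration `ξ` are i.i.d. uniform on the circle. -/
def IsIIDUniform {Ω : Type*} {mΩ : MeasurableSpace Ω} (P : Measure Ω) (ξ : Ω → Config) : Prop :=
  iIndepFun (fun (v : ℤ) ω => ξ ω v) P ∧
    ∀ v : ℤ, HasLaw (fun ω => ξ ω v) (AddCircle.haarAddCircle : Measure Opinion) P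

/-- The configuration with the value `s` at all vertices. -/
def constConfig (s : Opinion) : Config := fun _ => s

theorem measurable_constConfig : Measurable constConfig :=
  measurable_pi_lambda _ fun _ => measurable_id

/-- The mixture of the point masses at the constant configurations, with uniform value. -/
def constMixture : ProbabilityMeasure Config :=
  ⟨(AddCircle.haarAddCircle : Measure Opinion).bind fun s => Measure.dirac (constConfig s),
    isProbabilityMeasure_bind
      (Measure.measurable_dirac.comp measurable_constConfig).aemeasurable
      (Eventually.of_forall fun _ => inferInstance)⟩

/-- The law at time `t` of a compass model. -/
def lawAt {μ : ℝ} {Ω : Type*} {mΩ : MeasurableSpace Ω} {P : Measure Ω} [IsProbabilityMeasure P]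
    {ℱ : Filtration ℝ≥0 mΩ} {η : ℝ≥0 → Ω → Config} (h : IsCompassModel μ P ℱ η) (t : ℝ≥0) :
    ProbabilityMeasure Config :=
  ⟨P.map (η t), Measure.isProbabilityMeasure_map (h.measurable t).aemeasurable⟩

end CompassModel

end

noncomputable section

namespace CompassModel

/-! ### Geodesics -/

/-! An update along `⟨u, u + 1⟩` multiplies the discrepancy `gap u` by `1 - 2 * μ` and raises each
of the two adjacent discrepancies by at most `μ * gap u`. Total discrepancy is thus never created;
what disappears is `loss`, the defect in two triangle inequalities. Under a shift-invariant law, the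
generator applied to `gap 0` has mean minus the mean loss (`integral_generator_gap`), so the
expected gap decreases and the expected loss is integrable over time (`negligible_loss`).

Suppose the expected gap stayed above some `c > 0`. Pulled back through an update at `u`, a weighted
sum `∑ q v * gap v` becomes the sum for the relaxed weights `q + μ Δq(u) δ_u`, up to a multiple of
the loss (`weightedGap_step_le`). Starting from `gap 0 ≤ 1`, every reachable `q` therefore satisfies
`∑ q v * gap v ≤ 1 + g` with `∫ E g dt < ∞` (`Reachable.exists_negligible`). Vertex `0` is never
relaxed and acts as a source held at height `1`, so the mass of `q` can be made larger than `2 / c`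
(`exists_reachable_mass_gt`). By shift invariance the left side then has mean at least `2`, so `E g
≥ 1` at all times, which is absurd. Hence neighbours agree in the limit (`tendsto_integral_gap`),
any finite window is close to the constant `η 0`, and `η 0` is uniform by rotation invariance.

Both invariances pass from time `0` to time `t` because the forward equation has a unique solution
(`IsForwardSolution.unique`). Updates are discontinuous at opposed opinions, so the generator does
not preserve continuity; the forward equation is first extended from test functions to bounded
measurable local functions (`IsCompassModel.forward`). -/

theorem coe_arc (x y : Opinion) : ((arc x y : ℝ) : Opinion) = y - x :=
  AddCircle.coe_equivIoc

theorem arc_mem (x y : Opinion) : arc x y ∈ Set.Ioc (-1 : ℝ) 1 := by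
  have h := (AddCircle.equivIoc (2 : ℝ) (-1) (y - x)).2
  exact ⟨h.1, h.2.trans (by norm_num)⟩

theorem coe_geodesic (k : Bool) (x y : Opinion) : ((geodesic k x y : ℝ) : Opinion) = y - x := by
  unfold geodesic
  have h2 : ((2 : ℝ) : Opinion) = 0 := AddCircle.coe_period 2
  split_ifs with h hk
  · rw [← h, coe_arc]
  · rw [← coe_arc, h]
    rw [← add_zero ((-1 : ℝ) : Opinion), ← h2, ← AddCircle.coe_add]
    norm_num
  · exact coe_arc x y

theorem abs_geodesic_le_one (k : Bool) (x y : Opinion) : |geodesic k x y| ≤ 1 := by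
  unfold geodesic
  have h := arc_mem x y
  split_ifs
  · simp
  · simp
  · exact abs_le.2 ⟨h.1.le, h.2⟩

theorem norm_coe_of_abs_le_one {d : ℝ} (h : |d| ≤ 1) : ‖(d : Opinion)‖ = |d| := by
  rw [AddCircle.norm_coe_eq_abs_iff (2 : ℝ) two_ne_zero]
  simpa using h

theorem abs_geodesic (k : Bool) (x y : Opinion) : |geodesic k x y| = ‖y - x‖ := by
  rw [← coe_geodesic k, norm_coe_of_abs_le_one (abs_geodesic_le_one k x y)]

theorem norm_coe_le (d : ℝ) : ‖(d : Opinion)‖ ≤ |d| := by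
  exact QuotientAddGroup.norm_mk_le_norm

theorem norm_opinion_le_one (x : Opinion) : ‖x‖ ≤ 1 := by
  have := AddCircle.norm_le_half_period (2 : ℝ) (x := x) two_ne_zero
  simpa using this

theorem geodesic_add_right (k : Bool) (x y r : Opinion) :
    geodesic k (x + r) (y + r) = geodesic k x y := by
  unfold geodesic arc
  simp

theorem measurable_geodesic (k : Bool) :
    Measurable fun z : Opinion × Opinion => geodesic k z.1 z.2 := by
  have h : Measurable fun z : Opinion × Opinion => arc z.1 z.2 := by
    unfold arc
    exact measurable_subtype_coe.comp ((AddCircle.measurableEquivIoc (2 : ℝ) (-1)).measurable.comp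
      (measurable_snd.sub measurable_fst))
  unfold geodesic
  exact Measurable.ite (h (measurableSet_singleton 1)) measurable_const h

/-! ### Updates -/

theorem measurable_update (μ : ℝ) (k : Bool) (v : ℤ) : Measurable (update μ k v) := by
  refine measurable_pi_lambda _ fun w => ?_
  have hg : Measurable fun η : Config => ((μ * geodesic k (η v) (η (v + 1)) : ℝ) : Opinion) :=
    AddCircle.measurable_mk'.comp (((measurable_geodesic k).comp
      (g := fun z : Opinion × Opinion => geodesic k z.1 z.2) (f := fun η : Config => (η v, η (v + 1)))
      ((measurable_pi_apply v).prodMk (measurable_pi_apply (v + 1)))).const_mul μ)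
  unfold update
  split_ifs
  · exact (measurable_pi_apply v).add hg
  · exact (measurable_pi_apply (v + 1)).sub hg
  · exact measurable_pi_apply w

theorem update_left (μ : ℝ) (k : Bool) (v : ℤ) (η : Config) :
    update μ k v η v = η v + ((μ * geodesic k (η v) (η (v + 1)) : ℝ) : Opinion) := by
  simp [update]

theorem update_right (μ : ℝ) (k : Bool) (v : ℤ) (η : Config) :
    update μ k v η (v + 1) = η (v + 1) - ((μ * geodesic k (η v) (η (v + 1)) : ℝ) : Opinion) := by
  simp [update]

theorem update_of_ne {μ : ℝ} {k : Bool} {v w : ℤ} (η : Config) (h : w ≠ v) (h' : w ≠ v + 1) :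
    update μ k v η w = η w := by
  simp [update, h, h']

/-- The configuration seen from the vertex `z`. -/
def shift (z : ℤ) (η : Config) : Config := fun w => η (w + z)

/-- The configuration with all opinions rotated by `r`. -/
def rotate (r : Opinion) (η : Config) : Config := fun w => η w + r

theorem measurable_shift (z : ℤ) : Measurable (shift z) :=
  measurable_pi_lambda _ fun w => measurable_pi_apply (w + z)

theorem measurable_rotate (r : Opinion) : Measurable (rotate r) :=
  measurable_pi_lambda _ fun w => by
    unfold rotate
    exact (show Measurable fun η : Config => η w from measurable_pi_apply w).add_const r

theorem update_shift (μ : ℝ) (k : Bool) (v z : ℤ) (η : Config) :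
    update μ k v (shift z η) = shift z (update μ k (v + z) η) := by
  funext w
  have h1 : w + z = v + z ↔ w = v := by omega
  have h2 : w + z = v + z + 1 ↔ w = v + 1 := by omega
  have h3 : v + 1 + z = v + z + 1 := by ring
  simp only [update, shift, h1, h2, h3]

theorem update_rotate (μ : ℝ) (k : Bool) (v : ℤ) (r : Opinion) (η : Config) :
    update μ k v (rotate r η) = rotate r (update μ k v η) := by
  funext w
  simp only [update, rotate, geodesic_add_right]
  split_ifs
  · abel
  · abel
  · rfl

/-! ### Local functions -/

/-- Bounded measurable functions of finitely many coordinates. -/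
structure IsLocal (f : Config → ℝ) : Prop where
  measurable : Measurable f
  bounded : ∃ M, ∀ η, |f η| ≤ M
  dependsOn : ∃ n : ℕ, DependsOn f (Finset.Icc (-n : ℤ) n : Set ℤ)

theorem exists_subset_Icc (Λ : Finset ℤ) : ∃ n : ℕ, Λ ⊆ Finset.Icc (-n : ℤ) n := by
  refine ⟨Λ.sup Int.natAbs, fun v hv => ?_⟩
  have := Finset.le_sup (f := Int.natAbs) hv
  rw [Finset.mem_Icc]
  omega

theorem IsLocal.of_finset {f : Config → ℝ} (hf : Measurable f) {M : ℝ} (hM : ∀ η, |f η| ≤ M)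
    (Λ : Finset ℤ) (h : DependsOn f (Λ : Set ℤ)) : IsLocal f := by
  obtain ⟨n, hn⟩ := exists_subset_Icc Λ
  exact ⟨hf, ⟨M, hM⟩, n, h.mono (by exact_mod_cast hn)⟩

theorem dependsOn_Icc_mono {f : Config → ℝ} {m n : ℕ} (h : m ≤ n)
    (hf : DependsOn f (Finset.Icc (-m : ℤ) m : Set ℤ)) :
    DependsOn f (Finset.Icc (-n : ℤ) n : Set ℤ) := by
  refine hf.mono ?_
  have : Finset.Icc (-m : ℤ) m ⊆ Finset.Icc (-n : ℤ) n :=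
    Finset.Icc_subset_Icc (by omega) (by omega)
  exact_mod_cast this

theorem isLocal_const (c : ℝ) : IsLocal fun _ => c :=
  ⟨measurable_const, ⟨|c|, fun _ => le_rfl⟩, 0, fun _ _ _ => rfl⟩

theorem IsLocal.add {f g : Config → ℝ} (hf : IsLocal f) (hg : IsLocal g) :
    IsLocal fun η => f η + g η := by
  obtain ⟨hfm, ⟨M, hM⟩, m, hm⟩ := hf
  obtain ⟨hgm, ⟨N, hN⟩, n, hn⟩ := hg
  refine ⟨hfm.add hgm, ⟨M + N, fun η => (abs_add_le _ _).trans (add_le_add (hM η) (hN η))⟩,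
    max m n, fun x y h => ?_⟩
  exact congrArg₂ (· + ·) (dependsOn_Icc_mono (le_max_left m n) hm h)
    (dependsOn_Icc_mono (le_max_right m n) hn h)

theorem IsLocal.const_mul {f : Config → ℝ} (hf : IsLocal f) (c : ℝ) :
    IsLocal fun η => c * f η := by
  obtain ⟨hfm, ⟨M, hM⟩, m, hm⟩ := hf
  refine ⟨hfm.const_mul c, ⟨|c| * M, fun η => ?_⟩, m, fun x y h => ?_⟩
  · rw [abs_mul]
    exact mul_le_mul_of_nonneg_left (hM η) (abs_nonneg c)
  · simp only
    rw [hm h]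

theorem IsLocal.sub {f g : Config → ℝ} (hf : IsLocal f) (hg : IsLocal g) :
    IsLocal fun η => f η - g η := by
  simpa [sub_eq_add_neg] using hf.add (hg.const_mul (-1))

theorem isLocal_sum {ι : Type*} (s : Finset ι) {f : ι → Config → ℝ}
    (hf : ∀ i ∈ s, IsLocal (f i)) : IsLocal fun η => ∑ i ∈ s, f i η := by
  classical
  induction s using Finset.induction_on with
  | empty => simpa using isLocal_const 0
  | insert i s hi ih =>
    simp only [Finset.sum_insert hi]
    exact (hf i (by simp)).add (ih fun j hj => hf j (by simp [hj]))

theorem update_congr {μ : ℝ} {k : Bool} {v w : ℤ} {x y : Config} (hw : x w = y w)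
    (hv : w = v ∨ w = v + 1 → x v = y v ∧ x (v + 1) = y (v + 1)) :
    update μ k v x w = update μ k v y w := by
  by_cases h : w = v ∨ w = v + 1
  · obtain ⟨h0, h1⟩ := hv h
    simp only [update, h0, h1, hw]
  · push Not at h
    rw [update_of_ne x h.1 h.2, update_of_ne y h.1 h.2, hw]

theorem dependsOn_comp_update {f : Config → ℝ} {n : ℕ} (μ : ℝ) (k : Bool) (v : ℤ)
    (hf : DependsOn f (Finset.Icc (-n : ℤ) n : Set ℤ)) :
    DependsOn (fun η => f (update μ k v η)) (Finset.Icc (-(n + 1 : ℕ) : ℤ) (n + 1 : ℕ) : Set ℤ) := by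
  intro x y h
  refine hf fun w hw => update_congr (h w ?_) fun hv => ⟨h _ ?_, h _ ?_⟩ <;>
  · simp only [Finset.coe_Icc, Set.mem_Icc, Nat.cast_add, Nat.cast_one] at hw ⊢
    omega

theorem IsLocal.comp_update {f : Config → ℝ} (hf : IsLocal f) (μ : ℝ) (k : Bool) (v : ℤ) :
    IsLocal fun η => f (update μ k v η) := by
  obtain ⟨hfm, ⟨M, hM⟩, m, hm⟩ := hf
  exact ⟨hfm.comp (measurable_update μ k v), ⟨M, fun η => hM _⟩, m + 1,
    dependsOn_comp_update μ k v hm⟩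

theorem IsLocal.comp_shift {f : Config → ℝ} (hf : IsLocal f) (z : ℤ) :
    IsLocal fun η => f (shift z η) := by
  obtain ⟨hfm, ⟨M, hM⟩, m, hm⟩ := hf
  refine ⟨hfm.comp (measurable_shift z), ⟨M, fun η => hM _⟩, m + z.natAbs, fun x y h => ?_⟩
  refine hm fun w hw => h _ ?_
  simp only [Finset.coe_Icc, Set.mem_Icc, Nat.cast_add] at hw ⊢
  omega

theorem IsLocal.comp_rotate {f : Config → ℝ} (hf : IsLocal f) (r : Opinion) :
    IsLocal fun η => f (rotate r η) := by
  obtain ⟨hfm, ⟨M, hM⟩, m, hm⟩ := hf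
  refine ⟨hfm.comp (measurable_rotate r), ⟨M, fun η => hM _⟩, m, fun x y h => ?_⟩
  exact hm fun w hw => by simp only [rotate, h w hw]

theorem IsLocal.integrable {f : Config → ℝ} (hf : IsLocal f) (m : Measure Config)
    [IsFiniteMeasure m] : Integrable f m := by
  obtain ⟨hfm, ⟨M, hM⟩, -⟩ := hf
  exact Integrable.of_bound hfm.aestronglyMeasurable M (Eventually.of_forall hM)

/-! ### The generator -/

/-- The mean effect of an update along the edge `⟨v, v + 1⟩`. -/
def edgeMean (μ : ℝ) (v : ℤ) (f : Config → ℝ) (η : Config) : ℝ :=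
  (1 / 2 : ℝ) * (f (update μ true v η) + f (update μ false v η))

theorem IsLocal.edgeMean {f : Config → ℝ} (hf : IsLocal f) (μ : ℝ) (v : ℤ) :
    IsLocal (edgeMean μ v f) :=
  ((hf.comp_update μ true v).add (hf.comp_update μ false v)).const_mul _

/-- An edge matters only if it has an endpoint in `[-n, n]`; the edge `-(n + 1)` still does, through
its right end. -/
theorem edgeMean_eq_self {f : Config → ℝ} {n : ℕ} (μ : ℝ) {v : ℤ}
    (hf : DependsOn f (Finset.Icc (-n : ℤ) n : Set ℤ))
    (hv : v ∉ Finset.Icc (-(n + 1) : ℤ) n) (η : Config) : edgeMean μ v f η = f η := by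
  have h : ∀ k, f (update μ k v η) = f η := fun k => by
    refine hf fun w hw => update_of_ne η ?_ ?_ <;>
    · simp only [Finset.coe_Icc, Set.mem_Icc, Finset.mem_Icc] at hw hv
      omega
  rw [edgeMean, h, h]
  ring

theorem generator_eq_sum {f : Config → ℝ} {n : ℕ} (μ : ℝ)
    (hf : DependsOn f (Finset.Icc (-n : ℤ) n : Set ℤ)) {E : Finset ℤ}
    (hE : Finset.Icc (-(n + 1) : ℤ) n ⊆ E) (η : Config) :
    generator μ f η = ∑ v ∈ E, (edgeMean μ v f η - f η) := by
  refine finsum_eq_sum_of_support_subset _ fun v hv => ?_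
  by_contra h
  exact hv (sub_eq_zero.2 (edgeMean_eq_self μ hf (fun h' => h (hE h')) η))

theorem IsLocal.generator {f : Config → ℝ} (hf : IsLocal f) (μ : ℝ) :
    IsLocal (generator μ f) := by
  obtain ⟨n, hn⟩ := hf.dependsOn
  have : CompassModel.generator μ f = fun η =>
      ∑ v ∈ Finset.Icc (-(n + 1) : ℤ) n, (CompassModel.edgeMean μ v f η - f η) :=
    funext (generator_eq_sum μ hn subset_rfl)
  rw [this]
  exact isLocal_sum _ fun v _ => (hf.edgeMean μ v).sub hf

theorem dependsOn_generator {f : Config → ℝ} {n : ℕ} (μ : ℝ)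
    (hf : DependsOn f (Finset.Icc (-n : ℤ) n : Set ℤ)) :
    DependsOn (generator μ f) (Finset.Icc (-(n + 1 : ℕ) : ℤ) (n + 1 : ℕ) : Set ℤ) := by
  intro x y h
  rw [generator_eq_sum μ hf subset_rfl, generator_eq_sum μ hf subset_rfl]
  refine Finset.sum_congr rfl fun v _ => ?_
  have h' := fun k => dependsOn_comp_update μ k v hf h
  simp only at h'
  rw [dependsOn_Icc_mono n.le_succ hf h, edgeMean, edgeMean, h', h']

/-- There are `2 * (n + 1)` relevant edges, each contributing at most `2 * M`. Growth that is only
linear in `n` is what makes the iteration in `abs_sub_le` converge for small times. -/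
theorem abs_generator_le {f : Config → ℝ} {n : ℕ} (μ : ℝ)
    (hf : DependsOn f (Finset.Icc (-n : ℤ) n : Set ℤ)) {M : ℝ} (hM : ∀ η, |f η| ≤ M)
    (η : Config) : |generator μ f η| ≤ 4 * (n + 1) * M := by
  rw [generator_eq_sum μ hf subset_rfl]
  refine (Finset.abs_sum_le_sum_abs _ _).trans ?_
  have h : ∀ v ∈ Finset.Icc (-(n + 1) : ℤ) n, |edgeMean μ v f η - f η| ≤ 2 * M := fun v _ => by
    have h1 := abs_le.1 (hM (update μ true v η))
    have h2 := abs_le.1 (hM (update μ false v η))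
    have h3 := abs_le.1 (hM η)
    rw [edgeMean, abs_le]
    constructor <;> linarith
  refine (Finset.sum_le_card_nsmul _ _ _ h).trans (le_of_eq ?_)
  have : ((n : ℤ) + 1 - -(n + 1)).toNat = 2 * (n + 1) := by omega
  rw [Int.card_Icc, this, nsmul_eq_mul]
  push_cast
  ring

theorem generator_comp {f : Config → ℝ} (μ : ℝ) (T : Config → Config) (e : ℤ ≃ ℤ)
    (hT : ∀ k v η, update μ k v (T η) = T (update μ k (e v) η)) (η : Config) :
    generator μ (fun η => f (T η)) η = generator μ f (T η) := by
  unfold generator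
  simp only [hT]
  exact (finsum_comp_equiv e (f := fun v => (1 / 2 : ℝ) * (f (T (update μ true v η)) +
    f (T (update μ false v η))) - f (T η))).symm

/-! ### The forward equation -/

/-- A family of probability measures that solves the forward equation of the compass model,
on all local functions. -/
structure IsForwardSolution (μ : ℝ) (p : ℝ → Measure Config) : Prop where
  isProbabilityMeasure : ∀ t, IsProbabilityMeasure (p t)
  measurable : ∀ f, IsLocal f → Measurable fun t => ∫ η, f η ∂p t
  forward : ∀ f, IsLocal f → ∀ t, 0 ≤ t →
    ∫ η, f η ∂p t = ∫ η, f η ∂p 0 + ∫ s in (0 : ℝ)..t, ∫ η, generator μ f η ∂p s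

namespace IsForwardSolution

variable {μ : ℝ} {p q : ℝ → Measure Config}

theorem abs_integral_le (hp : IsForwardSolution μ p) {f : Config → ℝ} {M : ℝ}
    (hM : ∀ η, |f η| ≤ M) (t : ℝ) : |∫ η, f η ∂p t| ≤ M := by
  have := hp.isProbabilityMeasure t
  simpa using norm_integral_le_of_norm_le_const (μ := p t) (f := f) (Eventually.of_forall hM)

theorem intervalIntegrable (hp : IsForwardSolution μ p) {f : Config → ℝ} (hf : IsLocal f)
    (a b : ℝ) : IntervalIntegrable (fun s => ∫ η, f η ∂p s) volume a b := by
  obtain ⟨M, hM⟩ := hf.bounded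
  exact (intervalIntegrable_const (c := M)).mono_fun' (hp.measurable f hf).aestronglyMeasurable
    (Eventually.of_forall fun s => hp.abs_integral_le hM s)

theorem integrable (hp : IsForwardSolution μ p) {f : Config → ℝ} (hf : IsLocal f) (t : ℝ) :
    Integrable f (p t) :=
  have := hp.isProbabilityMeasure t
  hf.integrable (p t)

theorem comp_add (hp : IsForwardSolution μ p) {r : ℝ} (hr : 0 ≤ r) :
    IsForwardSolution μ fun t => p (t + r) where
  isProbabilityMeasure t := hp.isProbabilityMeasure _
  measurable f hf := (hp.measurable f hf).comp (measurable_add_const r)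
  forward f hf t ht := by
    rw [hp.forward f hf (t + r) (by positivity), zero_add, hp.forward f hf r hr,
      intervalIntegral.integral_comp_add_right (fun s => ∫ η, generator μ f η ∂p s), zero_add,
      add_assoc, intervalIntegral.integral_add_adjacent_intervals
        (hp.intervalIntegrable (hf.generator μ) _ _) (hp.intervalIntegrable (hf.generator μ) _ _)]

theorem map (hp : IsForwardSolution μ p) {T : Config → Config} (hT : Measurable T)
    (hlocal : ∀ f, IsLocal f → IsLocal fun η => f (T η)) (e : ℤ ≃ ℤ)
    (hcomm : ∀ k v η, update μ k v (T η) = T (update μ k (e v) η)) :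
    IsForwardSolution μ fun t => (p t).map T where
  isProbabilityMeasure t :=
    have := hp.isProbabilityMeasure t
    Measure.isProbabilityMeasure_map hT.aemeasurable
  measurable f hf := by
    simp only [integral_map hT.aemeasurable hf.measurable.aestronglyMeasurable]
    exact hp.measurable _ (hlocal f hf)
  forward f hf t ht := by
    simp only [integral_map hT.aemeasurable hf.measurable.aestronglyMeasurable,
      integral_map hT.aemeasurable (hf.generator μ).measurable.aestronglyMeasurable]
    rw [hp.forward _ (hlocal f hf) t ht]
    simp only [generator_comp μ T e hcomm]

/-! ### Uniqueness -/

/-- Picard iteration: each use of the forward equation widens the window by one, costs a factor `4 *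
(n + 1)` and adds one time integration. The product `(n + 1) ⋯ (n + k) / k!` is the binomial
coefficient. -/
theorem abs_sub_le (hp : IsForwardSolution μ p) (hq : IsForwardSolution μ q)
    (h0 : ∀ f, IsLocal f → ∫ η, f η ∂p 0 = ∫ η, f η ∂q 0) (k : ℕ) :
    ∀ (n : ℕ) (f : Config → ℝ) (M : ℝ), Measurable f → (∀ η, |f η| ≤ M) →
      DependsOn f (Finset.Icc (-n : ℤ) n : Set ℤ) → ∀ t, 0 ≤ t →
      |∫ η, f η ∂p t - ∫ η, f η ∂q t| ≤ 2 * M * (4 * t) ^ k * (n + k).choose k := by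
  induction k with
  | zero =>
    intro n f M _ hM _ t _
    have h1 := abs_le.1 (hp.abs_integral_le hM t)
    have h2 := abs_le.1 (hq.abs_integral_le hM t)
    simp only [pow_zero, Nat.choose_zero_right, Nat.cast_one, mul_one]
    rw [abs_le]
    constructor <;> linarith
  | succ k ih =>
    intro n f M hfm hM hn t ht
    have hf : IsLocal f := ⟨hfm, ⟨M, hM⟩, n, hn⟩
    have hg := hf.generator μ
    rw [hp.forward f hf t ht, hq.forward f hf t ht, h0 f hf, add_sub_add_left_eq_sub,
      ← intervalIntegral.integral_sub (hp.intervalIntegrable hg _ _)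
        (hq.intervalIntegrable hg _ _)]
    set c : ℝ := 2 * (4 * (n + 1) * M) * 4 ^ k * (n + 1 + k).choose k with hc
    have hb : ∀ s ∈ Set.Ioc 0 t,
        ‖∫ η, generator μ f η ∂p s - ∫ η, generator μ f η ∂q s‖ ≤ c * s ^ k := by
      intro s hs
      have := ih (n + 1) _ _ hg.measurable (abs_generator_le μ hn hM) (dependsOn_generator μ hn)
        s hs.1.le
      rw [Real.norm_eq_abs]
      refine this.trans (le_of_eq ?_)
      rw [hc, mul_pow]
      ring
    have hi : IntervalIntegrable (fun s : ℝ => c * s ^ k) volume 0 t :=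
      Continuous.intervalIntegrable (by fun_prop) _ _
    have h := intervalIntegral.norm_integral_le_of_norm_le ht (Eventually.of_forall hb) hi
    rw [Real.norm_eq_abs] at h
    refine h.trans (le_of_eq ?_)
    rw [intervalIntegral.integral_const_mul, integral_pow, hc]
    have hch : ((n + 1 + k).choose k : ℝ) * (n + 1) =
        (n + (k + 1)).choose (k + 1) * (k + 1) := by
      have := Nat.choose_succ_right_eq (n + 1 + k) k
      rw [Nat.add_sub_cancel] at this
      rw [show n + (k + 1) = n + 1 + k by ring]
      exact_mod_cast this.symm
    have hk : (k : ℝ) + 1 ≠ 0 := by positivity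
    rw [zero_pow (Nat.succ_ne_zero k), sub_zero, mul_pow]
    field_simp
    linear_combination (4 * M * 4 ^ k * t ^ (k + 1) : ℝ) * hch

theorem eq_of_le (hp : IsForwardSolution μ p) (hq : IsForwardSolution μ q)
    (h0 : ∀ f, IsLocal f → ∫ η, f η ∂p 0 = ∫ η, f η ∂q 0) {t : ℝ} (ht : 0 ≤ t)
    (ht' : t ≤ 1 / 16) {f : Config → ℝ} (hf : IsLocal f) : ∫ η, f η ∂p t = ∫ η, f η ∂q t := by
  obtain ⟨hfm, ⟨M, hM⟩, n, hn⟩ := hf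
  have hM0 : 0 ≤ M := (abs_nonneg _).trans (hM fun _ => 0)
  have hlim : Tendsto (fun k : ℕ => 2 * M * 2 ^ n * (1 / 2 : ℝ) ^ k) atTop (𝓝 0) := by
    simpa using (tendsto_pow_atTop_nhds_zero_of_lt_one (r := (1 / 2 : ℝ)) (by norm_num)
      (by norm_num)).const_mul (2 * M * 2 ^ n)
  have hle : |∫ η, f η ∂p t - ∫ η, f η ∂q t| ≤ 0 := by
    refine ge_of_tendsto' hlim fun k => (hp.abs_sub_le hq h0 k n f M hfm hM hn t ht).trans ?_
    have h1 : (4 * t) ^ k ≤ (1 / 4 : ℝ) ^ k := pow_le_pow_left₀ (by positivity) (by linarith) k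
    have h2 : ((n + k).choose k : ℝ) ≤ 2 ^ (n + k) := by
      exact_mod_cast Nat.choose_le_two_pow (n + k) k
    calc 2 * M * (4 * t) ^ k * (n + k).choose k ≤ 2 * M * (1 / 4 : ℝ) ^ k * 2 ^ (n + k) := by
          gcongr
      _ = 2 * M * 2 ^ n * (1 / 2 : ℝ) ^ k := by
          rw [pow_add, show (1 / 2 : ℝ) = 1 / 4 * 2 by norm_num, mul_pow]
          ring
  exact sub_eq_zero.1 (abs_nonpos_iff.1 hle)

/-- A solution of the forward equation is determined by its initial distribution. -/
theorem unique (hp : IsForwardSolution μ p) (hq : IsForwardSolution μ q)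
    (h0 : ∀ f, IsLocal f → ∫ η, f η ∂p 0 = ∫ η, f η ∂q 0) {t : ℝ} (ht : 0 ≤ t)
    {f : Config → ℝ} (hf : IsLocal f) : ∫ η, f η ∂p t = ∫ η, f η ∂q t := by
  -- The span `1 / 16` does not depend on `f`, so the short-time result can be restarted along a
  -- grid.
  have key : ∀ m : ℕ, ∀ f, IsLocal f → ∫ η, f η ∂p (m * (1 / 16)) = ∫ η, f η ∂q (m * (1 / 16)) := by
    intro m
    induction m with
    | zero => simpa using h0
    | succ m ih =>
      intro f hf
      have hm : (0 : ℝ) ≤ m * (1 / 16) := by positivity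
      have := (hp.comp_add hm).eq_of_le (hq.comp_add hm) (by simpa using ih)
        (t := 1 / 16) (by norm_num) le_rfl hf
      have e : ((m + 1 : ℕ) : ℝ) * (1 / 16) = 1 / 16 + m * (1 / 16) := by push_cast; ring
      rw [e]
      exact this
  set m := ⌊t * 16⌋₊
  have h1 : (m : ℝ) ≤ t * 16 := Nat.floor_le (by positivity)
  have h2 : t * 16 < m + 1 := Nat.lt_floor_add_one _
  have hm : (0 : ℝ) ≤ m * (1 / 16) := by positivity
  have := (hp.comp_add hm).eq_of_le (hq.comp_add hm) (by simpa using key m)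
    (t := t - m * (1 / 16)) (by linarith) (by linarith) hf
  simpa using this

/-- The image of a solution under a symmetry of the dynamics is again a solution, here with the same
initial law, so uniqueness applies. -/
theorem integral_comp_eq (hp : IsForwardSolution μ p) {T : Config → Config} (hT : Measurable T)
    (hlocal : ∀ f, IsLocal f → IsLocal fun η => f (T η)) (e : ℤ ≃ ℤ)
    (hcomm : ∀ k v η, update μ k v (T η) = T (update μ k (e v) η)) (h0 : (p 0).map T = p 0)
    {t : ℝ} (ht : 0 ≤ t) {f : Config → ℝ} (hf : IsLocal f) :
    ∫ η, f (T η) ∂p t = ∫ η, f η ∂p t := by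
  have := (hp.map hT hlocal e hcomm).unique hp (fun f _ => by rw [h0]) ht hf
  rwa [integral_map hT.aemeasurable hf.measurable.aestronglyMeasurable] at this

theorem integral_comp_shift (hp : IsForwardSolution μ p) {z : ℤ}
    (h0 : (p 0).map (shift z) = p 0) {t : ℝ} (ht : 0 ≤ t) {f : Config → ℝ} (hf : IsLocal f) :
    ∫ η, f (shift z η) ∂p t = ∫ η, f η ∂p t :=
  hp.integral_comp_eq (measurable_shift z) (fun _ hf => hf.comp_shift z) (Equiv.addRight z)
    (fun k v η => update_shift μ k v z η) h0 ht hf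

theorem integral_comp_rotate (hp : IsForwardSolution μ p) {r : Opinion}
    (h0 : (p 0).map (rotate r) = p 0) {t : ℝ} (ht : 0 ≤ t) {f : Config → ℝ} (hf : IsLocal f) :
    ∫ η, f (rotate r η) ∂p t = ∫ η, f η ∂p t :=
  hp.integral_comp_eq (measurable_rotate r) (fun _ hf => hf.comp_rotate r) (Equiv.refl ℤ)
    (fun k v η => update_rotate μ k v r η) h0 ht hf

end IsForwardSolution

section

/-! ### Symmetries of the initial law -/

variable {μ : ℝ} {Ω : Type*} {mΩ : MeasurableSpace Ω} {P : Measure Ω}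
  {ℱ : Filtration ℝ≥0 mΩ} {η : ℝ≥0 → Ω → Config}

theorem IsIIDUniform.comp_shift {ξ : Ω → Config} (h : IsIIDUniform P ξ) (z : ℤ) :
    IsIIDUniform P fun ω => shift z (ξ ω) :=
  ⟨h.1.precomp (g := fun v : ℤ => v + z) (add_left_injective z), fun v => h.2 (v + z)⟩

theorem IsIIDUniform.comp_rotate {ξ : Ω → Config} (h : IsIIDUniform P ξ) (r : Opinion) :
    IsIIDUniform P fun ω => rotate r (ξ ω) := by
  refine ⟨h.1.comp (fun _ x => x + r) fun _ => measurable_add_const r, fun v => ?_⟩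
  have hr : HasLaw (fun x : Opinion => x + r) (AddCircle.haarAddCircle : Measure Opinion)
      AddCircle.haarAddCircle :=
    ⟨(measurable_add_const r).aemeasurable, map_add_right_eq_self _ r⟩
  exact hr.comp (h.2 v)

theorem IsIIDUniform.map_eq [IsProbabilityMeasure P] {ξ : Ω → Config} (hξ : Measurable ξ)
    (h : IsIIDUniform P ξ) :
    P.map ξ = Measure.infinitePi fun _ : ℤ => (AddCircle.haarAddCircle : Measure Opinion) := by
  have := (iIndepFun_iff_map_fun_eq_infinitePi_map
    fun v => (measurable_pi_apply v).comp hξ).1 h.1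
  exact this.trans (congrArg Measure.infinitePi (funext fun v => (h.2 v).map_eq))

theorem IsIIDUniform.map_shift [IsProbabilityMeasure P] {ξ : Ω → Config} (hξ : Measurable ξ)
    (h : IsIIDUniform P ξ)
    (z : ℤ) : (P.map ξ).map (shift z) = P.map ξ := by
  rw [Measure.map_map (measurable_shift z) hξ, h.map_eq hξ]
  exact (h.comp_shift z).map_eq ((measurable_shift z).comp hξ)

theorem IsIIDUniform.map_rotate [IsProbabilityMeasure P] {ξ : Ω → Config} (hξ : Measurable ξ)
    (h : IsIIDUniform P ξ)
    (r : Opinion) : (P.map ξ).map (rotate r) = P.map ξ := by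
  rw [Measure.map_map (measurable_rotate r) hξ, h.map_eq hξ]
  exact (h.comp_rotate r).map_eq ((measurable_rotate r).comp hξ)

/-! ### The compass model solves the forward equation -/

theorem IsTestFunction.isLocal {f : Config → ℝ} (hf : IsTestFunction f) : IsLocal f := by
  obtain ⟨hc, Λ, hΛ⟩ := hf
  obtain ⟨M, hM⟩ := isCompact_univ.exists_bound_of_continuousOn hc.continuousOn
  exact IsLocal.of_finset hc.measurable (fun η => hM η (Set.mem_univ η)) Λ hΛ

/-- Finite measures that agree on the test functions of the coordinates in `Λ` agree on all
bounded measurable functions of these coordinates. -/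
theorem integral_eq_of_forall_test {m₁ m₂ : Measure Config} [IsFiniteMeasure m₁]
    [IsFiniteMeasure m₂] {Λ : Finset ℤ}
    (h : ∀ f : Config → ℝ, Continuous f → DependsOn f (Λ : Set ℤ) →
      ∫ η, f η ∂m₁ = ∫ η, f η ∂m₂)
    {f : Config → ℝ} (hf : Measurable f) (hΛ : DependsOn f (Λ : Set ℤ)) :
    ∫ η, f η ∂m₁ = ∫ η, f η ∂m₂ := by
  classical
  have hr : Measurable (Λ.restrict : Config → Λ → Opinion) := Finset.measurable_restrict Λ
  have hmap : m₁.map (Λ.restrict : Config → Λ → Opinion) = m₂.map Λ.restrict := by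
    refine ext_of_forall_integral_eq_of_IsFiniteMeasure fun g => ?_
    rw [integral_map hr.aemeasurable g.continuous.aestronglyMeasurable,
      integral_map hr.aemeasurable g.continuous.aestronglyMeasurable]
    refine h _ (g.continuous.comp (by fun_prop)) fun x y hxy => ?_
    rw [Finset.dependsOn_restrict Λ hxy]
  -- The value `0` off `Λ` is arbitrary: `f` does not see it.
  let ext : (Λ → Opinion) → Config := fun x v => if hv : v ∈ Λ then x ⟨v, hv⟩ else 0
  have hext : Measurable ext := by
    refine measurable_pi_lambda _ fun v => ?_
    by_cases hv : v ∈ Λ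
    · simpa only [ext, hv, dif_pos] using measurable_pi_apply _
    · simpa only [ext, hv, dif_neg, not_false_iff] using measurable_const
  have hfe : ∀ η, f η = f (ext (Λ.restrict η)) := fun η => hΛ fun v hv => by
    have hv' : v ∈ Λ := hv
    simp [ext, hv']
  have hm : ∀ m : Measure Config,
      ∫ η, f η ∂m = ∫ x, f (ext x) ∂(m.map (Λ.restrict : Config → Λ → Opinion)) := fun m => by
    rw [integral_map (f := fun x => f (ext x)) hr.aemeasurable (hf.comp hext).aestronglyMeasurable]
    exact integral_congr_ae (Eventually.of_forall hfe)
  rw [hm, hm, hmap]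


theorem IsCompassModel.measurable_uncurry (h : IsCompassModel μ P ℱ η) :
    Measurable fun z : ℝ × Ω => η z.1.toNNReal z.2 := by
  -- Grid points to the right of `s`: the process read at them is jointly measurable, since the grid
  -- is countable, and right continuity gives the limit.
  let a : ℕ → ℝ≥0 → ℝ≥0 := fun n s => (⌊(n + 1) * s⌋₊ + 1) / (n + 1)
  have ha : ∀ s, Tendsto (fun n => a n s) atTop (𝓝[≥] s) := by
    intro s
    have hn : ∀ n : ℕ, (0 : ℝ≥0) < n + 1 := fun n => by positivity
    have hge : ∀ n, s ≤ a n s := fun n => by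
      rw [le_div_iff₀ (hn n), mul_comm]
      exact (Nat.lt_floor_add_one _).le
    have hle : ∀ n : ℕ, a n s ≤ s + 1 / (n + 1) := fun n => by
      rw [div_le_iff₀ (hn n), add_mul _ _ ((n : ℝ≥0) + 1), one_div,
        inv_mul_cancel₀ (hn n).ne', mul_comm s]
      gcongr
      exact Nat.floor_le (by positivity)
    refine tendsto_nhdsWithin_iff.2 ⟨?_, Eventually.of_forall hge⟩
    refine tendsto_of_tendsto_of_tendsto_of_le_of_le tendsto_const_nhds ?_ hge hle
    simpa using (tendsto_one_div_add_atTop_nhds_zero_nat (𝕜 := ℝ≥0)).const_add s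
  refine measurable_pi_lambda _ fun v => ?_
  refine measurable_of_tendsto_metrizable (f := fun n (z : ℝ × Ω) => η (a n z.1.toNNReal) z.2 v)
    (fun n => ?_) (tendsto_pi_nhds.2 fun z => ?_)
  · have h1 : Measurable fun y : ℕ × Ω => η ((y.1 + 1) / (n + 1)) y.2 v :=
      measurable_from_prod_countable_right fun k =>
        (measurable_pi_apply v).comp (h.measurable ((k + 1) / (n + 1)))
    have h2 : Measurable fun z : ℝ × Ω => (⌊((n : ℝ≥0) + 1) * z.1.toNNReal⌋₊, z.2) :=
      (Nat.measurable_floor.comp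
        ((measurable_real_toNNReal.comp measurable_fst).const_mul _)).prodMk measurable_snd
    exact (h1.comp h2 :)
  · have h1 := (h.right_continuous z.2 z.1.toNNReal).tendsto.comp (ha z.1.toNNReal)
    exact (tendsto_pi_nhds.1 h1) v

/-- The law of the process at time `t`, extended by the initial law to negative times. -/
def pathLaw (P : Measure Ω) (η : ℝ≥0 → Ω → Config) (t : ℝ) : Measure Config :=
  P.map (η t.toNNReal)

theorem IsCompassModel.integral_pathLaw (h : IsCompassModel μ P ℱ η) {f : Config → ℝ}
    (hf : IsLocal f) (t : ℝ) : ∫ x, f x ∂pathLaw P η t = ∫ ω, f (η t.toNNReal ω) ∂P :=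
  integral_map (h.measurable _).aemeasurable hf.measurable.aestronglyMeasurable

/-- The occupation measure of the process in the time interval `(0, t]`. -/
def occupation (P : Measure Ω) (η : ℝ≥0 → Ω → Config) (t : ℝ) : Measure Config :=
  ((volume.restrict (Set.Ioc 0 t)).prod P).map fun z : ℝ × Ω => η z.1.toNNReal z.2

variable [IsProbabilityMeasure P]

instance isFiniteMeasure_occupation (t : ℝ) : IsFiniteMeasure (occupation P η t) := by
  unfold occupation
  infer_instance

theorem IsCompassModel.integral_occupation (h : IsCompassModel μ P ℱ η) {f : Config → ℝ}
    (hf : IsLocal f) {t : ℝ} (ht : 0 ≤ t) :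
    ∫ x, f x ∂occupation P η t = ∫ s in (0 : ℝ)..t, ∫ x, f x ∂pathLaw P η s ∧
    ∫ x, f x ∂occupation P η t = ∫ ω, (∫ s in (0 : ℝ)..t, f (η s.toNNReal ω)) ∂P := by
  obtain ⟨M, hM⟩ := hf.bounded
  have hm : Measurable fun z : ℝ × Ω => f (η z.1.toNNReal z.2) :=
    hf.measurable.comp h.measurable_uncurry
  have hi : Integrable (fun z : ℝ × Ω => f (η z.1.toNNReal z.2))
      ((volume.restrict (Set.Ioc 0 t)).prod P) :=
    Integrable.of_bound hm.aestronglyMeasurable M (Eventually.of_forall fun z => hM _)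
  unfold occupation
  rw [integral_map h.measurable_uncurry.aemeasurable hf.measurable.aestronglyMeasurable]
  constructor
  · rw [integral_prod _ hi, intervalIntegral.integral_of_le ht]
    simp only [h.integral_pathLaw hf]
  · rw [integral_prod_symm _ hi]
    simp only [intervalIntegral.integral_of_le ht]

theorem IsCompassModel.forward_of_test (h : IsCompassModel μ P ℱ η) {f : Config → ℝ}
    (hf : IsTestFunction f) {t : ℝ} (ht : 0 ≤ t) :
    ∫ x, f x ∂pathLaw P η t =
      ∫ x, f x ∂pathLaw P η 0 + ∫ x, generator μ f x ∂occupation P η t := by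
  have hl := hf.isLocal
  have hmart := h.martingale f hf
  have h1 := hmart.setIntegral_eq (zero_le (a := t.toNNReal)) MeasurableSet.univ
  have hint : ∀ s, Integrable (fun ω => f (η s ω)) P := fun s => by
    obtain ⟨M, hM⟩ := hl.bounded
    exact Integrable.of_bound (hl.measurable.comp (h.measurable s)).aestronglyMeasurable M
      (Eventually.of_forall fun ω => hM _)
  -- The time integral is the difference of a bounded variable and the martingale, both integrable.
  have hint' : Integrable (fun ω => ∫ s in (0 : ℝ)..t, generator μ f (η s.toNNReal ω)) P := by
    have := (hint t.toNNReal).sub (hmart.integrable t.toNNReal)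
    refine this.congr (Eventually.of_forall fun ω => ?_)
    simp [Real.coe_toNNReal t ht]
  simp only [setIntegral_univ, NNReal.coe_zero, intervalIntegral.integral_same, sub_zero,
    Real.coe_toNNReal t ht] at h1
  rw [integral_sub (hint _) hint'] at h1
  rw [h.integral_pathLaw hl, h.integral_pathLaw hl,
    (h.integral_occupation (hl.generator μ) ht).2, Real.toNNReal_zero]
  linarith

theorem integral_balance {ν m : Measure Config} [IsFiniteMeasure ν] [IsFiniteMeasure m]
    (μ : ℝ) (E : Finset ℤ) {f : Config → ℝ} (hf : IsLocal f) :
    ∫ x, f x ∂(m + ∑ v ∈ E, (1 / 2 : ℝ≥0) • (ν.map (update μ true v) + ν.map (update μ false v))) =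
      ∫ x, f x ∂m + ∑ v ∈ E, ∫ x, edgeMean μ v f x ∂ν := by
  rw [integral_add_measure (hf.integrable _) (hf.integrable _),
    integral_finsetSum_measure fun v _ => hf.integrable _]
  congr 1
  refine Finset.sum_congr rfl fun v _ => ?_
  rw [integral_smul_nnreal_measure, integral_add_measure (hf.integrable _) (hf.integrable _),
    integral_map (measurable_update μ _ v).aemeasurable hf.measurable.aestronglyMeasurable,
    integral_map (measurable_update μ _ v).aemeasurable hf.measurable.aestronglyMeasurable]
  unfold edgeMean
  rw [integral_const_mul, integral_add ((hf.comp_update μ true v).integrable ν)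
    ((hf.comp_update μ false v).integrable ν)]
  simp only [NNReal.smul_def, smul_eq_mul, NNReal.coe_div, NNReal.coe_one, NNReal.coe_ofNat]

theorem integral_add_sum {ν m : Measure Config} [IsFiniteMeasure ν] [IsFiniteMeasure m]
    (E : Finset ℤ) {f : Config → ℝ} (hf : IsLocal f) :
    ∫ x, f x ∂(m + ∑ _v ∈ E, ν) = ∫ x, f x ∂m + ∑ _v ∈ E, ∫ x, f x ∂ν := by
  rw [integral_add_measure (hf.integrable _) (hf.integrable _),
    integral_finsetSum_measure fun v _ => hf.integrable _]

theorem integral_generator {ν : Measure Config} [IsFiniteMeasure ν] (μ : ℝ) {f : Config → ℝ}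
    (hf : IsLocal f) {n : ℕ} (hn : DependsOn f (Finset.Icc (-n : ℤ) n : Set ℤ))
    {E : Finset ℤ} (hE : Finset.Icc (-(n + 1) : ℤ) n ⊆ E) :
    ∫ x, generator μ f x ∂ν = ∑ v ∈ E, ∫ x, edgeMean μ v f x ∂ν - ∑ _v ∈ E, ∫ x, f x ∂ν := by
  simp only [generator_eq_sum μ hn hE]
  rw [integral_finsetSum _ fun v _ => ((hf.edgeMean μ v).sub hf).integrable ν,
    ← Finset.sum_sub_distrib]
  exact Finset.sum_congr rfl fun v _ =>
    integral_sub ((hf.edgeMean μ v).integrable ν) (hf.integrable ν)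

/-- With the negative terms of the generator moved to the other side, the forward equation equates
the integrals of `f` against two positive finite measures. They agree on continuous functions of the
window, hence on measurable ones. -/
theorem IsCompassModel.forward (h : IsCompassModel μ P ℱ η) {f : Config → ℝ}
    (hf : IsLocal f) {t : ℝ} (ht : 0 ≤ t) :
    ∫ x, f x ∂pathLaw P η t =
      ∫ x, f x ∂pathLaw P η 0 + ∫ x, generator μ f x ∂occupation P η t := by
  obtain ⟨n, hn⟩ := hf.dependsOn
  have hprob : ∀ s, IsProbabilityMeasure (pathLaw P η s) := fun s =>
    Measure.isProbabilityMeasure_map (h.measurable _).aemeasurable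
  have key := integral_eq_of_forall_test (Λ := Finset.Icc (-n : ℤ) n)
    (m₁ := pathLaw P η t + ∑ _v ∈ Finset.Icc (-(n + 1) : ℤ) n, occupation P η t)
    (m₂ := pathLaw P η 0 + ∑ v ∈ Finset.Icc (-(n + 1) : ℤ) n, (1 / 2 : ℝ≥0) •
      ((occupation P η t).map (update μ true v) + (occupation P η t).map (update μ false v)))
    (fun g hg hgn => by
      have hgl : IsLocal g := IsTestFunction.isLocal ⟨hg, _, hgn⟩
      rw [integral_add_sum _ hgl, integral_balance _ _ hgl, h.forward_of_test ⟨hg, _, hgn⟩ ht,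
        integral_generator μ hgl hgn subset_rfl]
      ring) hf.measurable hn
  rw [integral_add_sum _ hf, integral_balance _ _ hf] at key
  rw [integral_generator μ hf hn subset_rfl]
  linarith

theorem IsCompassModel.isForwardSolution (h : IsCompassModel μ P ℱ η) :
    IsForwardSolution μ (pathLaw P η) where
  isProbabilityMeasure s := Measure.isProbabilityMeasure_map (h.measurable _).aemeasurable
  measurable f hf := by
    simp only [h.integral_pathLaw hf]
    exact (StronglyMeasurable.integral_prod_right' (ν := P)
      (hf.measurable.comp h.measurable_uncurry).stronglyMeasurable).measurable
  forward f hf t ht := by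
    rw [h.forward hf ht, (h.integral_occupation (hf.generator μ) ht).1]

end

/-! ### Discrepancies of neighbouring opinions -/

/-- The distance of the opinions at `v` and `v + 1`. -/
def gap (v : ℤ) (η : Config) : ℝ := ‖η (v + 1) - η v‖

theorem gap_nonneg (v : ℤ) (η : Config) : 0 ≤ gap v η := norm_nonneg _

theorem gap_le_one (v : ℤ) (η : Config) : gap v η ≤ 1 := norm_opinion_le_one _

theorem isLocal_norm_sub (v w : ℤ) : IsLocal fun η => ‖η v - η w‖ := by
  refine IsLocal.of_finset (M := 1) (Λ := {v, w}) ?_ (fun η => ?_) fun x y h => ?_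
  · exact ((show Measurable fun η : Config => η v from measurable_pi_apply v).sub
      (show Measurable fun η : Config => η w from measurable_pi_apply w)).norm
  · rw [abs_norm]
    exact norm_opinion_le_one _
  · have h1 := h v (by simp)
    have h2 := h w (by simp)
    simp only [h1, h2]

theorem isLocal_gap (v : ℤ) : IsLocal (gap v) := isLocal_norm_sub (v + 1) v

theorem gap_shift (v z : ℤ) (η : Config) : gap v (shift z η) = gap (v + z) η := by
  simp only [gap, shift, add_right_comm]

theorem gap_update_of_ne {μ : ℝ} {k : Bool} {u v : ℤ} (η : Config) (h : v ≠ u - 1) (h' : v ≠ u)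
    (h'' : v ≠ u + 1) : gap v (update μ k u η) = gap v η := by
  rw [gap, update_of_ne η (by omega) (by omega), update_of_ne η h' h'', gap]

/-- Both ends move along the same geodesic. What is left of it has length at most `1`, hence is
still a shortest arc and its length is the new distance. -/
theorem gap_update_self {μ : ℝ} (hμ : 0 ≤ μ) (hμ' : μ ≤ 1 / 2) (k : Bool) (u : ℤ) (η : Config) :
    gap u (update μ k u η) = (1 - 2 * μ) * gap u η := by
  have e : update μ k u η (u + 1) - update μ k u η u =
      (((1 - 2 * μ) * geodesic k (η u) (η (u + 1)) : ℝ) : Opinion) := by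
    have h : ((1 - 2 * μ) * geodesic k (η u) (η (u + 1)) : ℝ) =
      geodesic k (η u) (η (u + 1)) - μ * geodesic k (η u) (η (u + 1)) -
        μ * geodesic k (η u) (η (u + 1)) := by ring
    rw [update_left, update_right, h, AddCircle.coe_sub, AddCircle.coe_sub, coe_geodesic]
    abel
  have h1 := abs_geodesic_le_one k (η u) (η (u + 1))
  rw [gap, e, norm_coe_of_abs_le_one, abs_mul, abs_geodesic, abs_of_nonneg (by linarith), gap]
  rw [abs_mul, abs_of_nonneg (by linarith : 0 ≤ 1 - 2 * μ)]
  nlinarith [abs_nonneg (geodesic k (η u) (η (u + 1)))]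

theorem norm_coe_mul_geodesic_le {μ : ℝ} (hμ : 0 ≤ μ) (k : Bool) (u : ℤ) (η : Config) :
    ‖((μ * geodesic k (η u) (η (u + 1)) : ℝ) : Opinion)‖ ≤ μ * gap u η := by
  refine (norm_coe_le _).trans (le_of_eq ?_)
  rw [abs_mul, abs_of_nonneg hμ, abs_geodesic, gap]

theorem gap_update_left_le {μ : ℝ} (hμ : 0 ≤ μ) (k : Bool) (u : ℤ) (η : Config) :
    gap (u - 1) (update μ k u η) ≤ gap (u - 1) η + μ * gap u η := by
  have h := norm_coe_mul_geodesic_le hμ k u η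
  rw [gap, sub_add_cancel, update_left, update_of_ne η (by omega) (by omega), add_sub_right_comm,
    gap, sub_add_cancel]
  exact (norm_add_le _ _).trans (add_le_add_right h _)

theorem gap_update_right_le {μ : ℝ} (hμ : 0 ≤ μ) (k : Bool) (u : ℤ) (η : Config) :
    gap (u + 1) (update μ k u η) ≤ gap (u + 1) η + μ * gap u η := by
  have h := norm_coe_mul_geodesic_le hμ k u η
  rw [gap, update_right, update_of_ne η (by omega) (by omega), sub_sub_eq_add_sub,
    add_sub_right_comm, gap]
  exact (norm_add_le _ _).trans (add_le_add_right h _)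

/-- The total discrepancy that is lost at an update along the edge `⟨u, u + 1⟩`. -/
def loss (μ : ℝ) (k : Bool) (u : ℤ) (η : Config) : ℝ :=
  (gap (u - 1) η + μ * gap u η - gap (u - 1) (update μ k u η)) +
    (gap (u + 1) η + μ * gap u η - gap (u + 1) (update μ k u η))

theorem loss_nonneg {μ : ℝ} (hμ : 0 ≤ μ) (k : Bool) (u : ℤ) (η : Config) : 0 ≤ loss μ k u η :=
  add_nonneg (sub_nonneg.2 (gap_update_left_le hμ k u η))
    (sub_nonneg.2 (gap_update_right_le hμ k u η))

theorem isLocal_loss (μ : ℝ) (k : Bool) (u : ℤ) : IsLocal (loss μ k u) :=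
  (((isLocal_gap _).add ((isLocal_gap u).const_mul μ)).sub ((isLocal_gap _).comp_update μ k u)).add
    (((isLocal_gap _).add ((isLocal_gap u).const_mul μ)).sub ((isLocal_gap _).comp_update μ k u))

theorem loss_shift (μ : ℝ) (k : Bool) (u z : ℤ) (η : Config) :
    loss μ k u (shift z η) = loss μ k (u + z) η := by
  simp only [loss, update_shift, gap_shift, sub_add_eq_add_sub, add_right_comm]

/-! ### Negligible functions -/

/-- Nonnegative local functions whose expectation is integrable over time. -/
structure Negligible (p : ℝ → Measure Config) (g : Config → ℝ) : Prop where
  isLocal : IsLocal g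
  nonneg : ∀ η, 0 ≤ g η
  bounded : ∃ C, ∀ t, 0 ≤ t → ∫ s in (0 : ℝ)..t, ∫ η, g η ∂p s ≤ C

section

variable {μ : ℝ} {p : ℝ → Measure Config}

theorem Negligible.zero : Negligible p fun _ => 0 :=
  ⟨isLocal_const 0, fun _ => le_rfl, 0, by simp⟩

theorem Negligible.add (hp : IsForwardSolution μ p) {f g : Config → ℝ} (hf : Negligible p f)
    (hg : Negligible p g) : Negligible p fun η => f η + g η := by
  obtain ⟨C, hC⟩ := hf.bounded
  obtain ⟨D, hD⟩ := hg.bounded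
  refine ⟨hf.isLocal.add hg.isLocal, fun η => add_nonneg (hf.nonneg η) (hg.nonneg η), C + D,
    fun t ht => ?_⟩
  simp only [fun s => integral_add (hp.integrable hf.isLocal s) (hp.integrable hg.isLocal s)]
  rw [intervalIntegral.integral_add (hp.intervalIntegrable hf.isLocal _ _)
    (hp.intervalIntegrable hg.isLocal _ _)]
  exact add_le_add (hC t ht) (hD t ht)

theorem Negligible.const_mul {f : Config → ℝ} (hf : Negligible p f) {c : ℝ} (hc : 0 ≤ c) :
    Negligible p fun η => c * f η := by
  obtain ⟨C, hC⟩ := hf.bounded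
  refine ⟨hf.isLocal.const_mul c, fun η => mul_nonneg hc (hf.nonneg η), c * C, fun t ht => ?_⟩
  simp only [integral_const_mul, intervalIntegral.integral_const_mul]
  exact mul_le_mul_of_nonneg_left (hC t ht) hc

theorem Negligible.comp_shift (hp : IsForwardSolution μ p) {z : ℤ}
    (h0 : (p 0).map (shift z) = p 0) {f : Config → ℝ} (hf : Negligible p f) :
    Negligible p fun η => f (shift z η) := by
  obtain ⟨C, hC⟩ := hf.bounded
  refine ⟨hf.isLocal.comp_shift z, fun η => hf.nonneg _, C, fun t ht => le_trans (le_of_eq ?_)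
    (hC t ht)⟩
  refine intervalIntegral.integral_congr fun s hs => ?_
  rw [Set.uIcc_of_le ht] at hs
  exact hp.integral_comp_shift h0 hs.1 hf.isLocal

/-- Updates at `u` occur at a positive rate: since `f ≥ 0`, the generator is at least half of `f`
after the update minus `E.card * f`. Integrating over time and using the bound on `f` controls the
updated function. The edge `u` is put into `E` because it may lie outside the window of `f`. -/
theorem Negligible.comp_update (hp : IsForwardSolution μ p) {f : Config → ℝ}
    (hf : Negligible p f) (u : ℤ) : Negligible p fun η => f (update μ true u η) := by
  have hl := hf.isLocal
  obtain ⟨n, hn⟩ := hl.dependsOn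
  obtain ⟨M, hM⟩ := hl.bounded
  obtain ⟨C, hC⟩ := hf.bounded
  set E : Finset ℤ := insert u (Finset.Icc (-(n + 1) : ℤ) n)
  refine ⟨hl.comp_update μ true u, fun η => hf.nonneg _, 2 * (M + E.card * C), fun t ht => ?_⟩
  have hlow : ∀ s, 1 / 2 * ∫ η, f (update μ true u η) ∂p s - E.card * ∫ η, f η ∂p s ≤
      ∫ η, generator μ f η ∂p s := by
    intro s
    have := hp.isProbabilityMeasure s
    rw [integral_generator μ hl hn (Finset.subset_insert u _), Finset.sum_const, nsmul_eq_mul]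
    refine sub_le_sub_right ?_ _
    have hpos : ∀ v η, 0 ≤ edgeMean μ v f η := fun v η =>
      mul_nonneg (by norm_num) (add_nonneg (hf.nonneg _) (hf.nonneg _))
    refine le_trans ?_ (Finset.single_le_sum (fun v _ => integral_nonneg (hpos v))
      (Finset.mem_insert_self u _))
    rw [← integral_const_mul]
    refine integral_mono (((hl.comp_update μ true u).const_mul _).integrable _)
      ((hl.edgeMean μ u).integrable _) fun η => ?_
    have := hf.nonneg (update μ false u η)
    simp only [edgeMean]
    linarith
  have hi := hp.intervalIntegrable (hl.comp_update μ true u) 0 t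
  have hi' := hp.intervalIntegrable hl 0 t
  have hint := intervalIntegral.integral_mono ht ((hi.const_mul (1 / 2)).sub (hi'.const_mul E.card))
    (hp.intervalIntegrable (hl.generator μ) 0 t) hlow
  rw [intervalIntegral.integral_sub (hi.const_mul (1 / 2)) (hi'.const_mul E.card),
    intervalIntegral.integral_const_mul, intervalIntegral.integral_const_mul] at hint
  have h1 := hp.forward f hl t ht
  have h2 := (abs_le.1 (hp.abs_integral_le hM t)).2
  have h3 : 0 ≤ ∫ η, f η ∂p 0 := integral_nonneg hf.nonneg
  have h4 : (E.card : ℝ) * ∫ s in (0 : ℝ)..t, ∫ η, f η ∂p s ≤ E.card * C :=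
    mul_le_mul_of_nonneg_left (hC t ht) (Nat.cast_nonneg _)
  linarith

theorem integral_gap (hp : IsForwardSolution μ p) (h0 : ∀ z, (p 0).map (shift z) = p 0) (v : ℤ)
    {t : ℝ} (ht : 0 ≤ t) : ∫ η, gap v η ∂p t = ∫ η, gap 0 η ∂p t := by
  rw [← hp.integral_comp_shift (h0 v) ht (isLocal_gap 0)]
  simp only [gap_shift, zero_add]

/-- Mass transport: by shift invariance, the edge `v` acts on `gap 0` in the mean as the edge `0`
acts on `gap (-v)`. The sum over `v` is the balance of all gaps under a single update. -/
theorem integral_generator_gap (hp : IsForwardSolution μ p) (hμ : 0 ≤ μ) (hμ' : μ ≤ 1 / 2)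
    (h0 : ∀ z, (p 0).map (shift z) = p 0) {t : ℝ} (ht : 0 ≤ t) :
    ∫ η, generator μ (gap 0) η ∂p t =
      -(1 / 2 * (∫ η, loss μ true 0 η ∂p t + ∫ η, loss μ false 0 η ∂p t)) := by
  have := hp.isProbabilityMeasure t
  have hn : DependsOn (gap 0) (Finset.Icc (-(1 : ℕ) : ℤ) (1 : ℕ) : Set ℤ) := fun x y h => by
    have h1 := h 0 (by simp)
    have h2 := h 1 (by simp)
    simp only [gap, zero_add, h1, h2]
  -- The edge `-2` comes from the symmetric window only; it has no effect and reappears as `gap 2`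
  -- in `hfar`.
  have hE : Finset.Icc (-((1 : ℕ) + 1) : ℤ) (1 : ℕ) ⊆ {-2, -1, 0, 1} := by decide
  have hmove : ∀ (k : Bool) (v : ℤ), ∫ η, gap 0 (update μ k v η) ∂p t =
      ∫ η, gap (-v) (update μ k 0 η) ∂p t := by
    intro k v
    rw [← hp.integral_comp_shift (h0 (-v)) ht ((isLocal_gap 0).comp_update μ k v)]
    simp only [update_shift, gap_shift, zero_add, add_neg_cancel]
  have hmean : ∀ v : ℤ, ∫ η, edgeMean μ v (gap 0) η ∂p t =
      1 / 2 * (∫ η, gap (-v) (update μ true 0 η) ∂p t +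
        ∫ η, gap (-v) (update μ false 0 η) ∂p t) := by
    intro v
    rw [← hmove, ← hmove, ← integral_add (((isLocal_gap 0).comp_update μ _ v).integrable _)
      (((isLocal_gap 0).comp_update μ _ v).integrable _), ← integral_const_mul]
    rfl
  have hloss : ∀ k, ∫ η, loss μ k 0 η ∂p t = (2 + 2 * μ) * ∫ η, gap 0 η ∂p t -
      ∫ η, gap (-1) (update μ k 0 η) ∂p t - ∫ η, gap 1 (update μ k 0 η) ∂p t := by
    intro k
    have i : ∀ v, Integrable (fun η => gap v η) (p t) := fun v => (isLocal_gap v).integrable _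
    have i' : Integrable (fun η => μ * gap 0 η) (p t) := (i 0).const_mul μ
    have j : ∀ v, Integrable (fun η => gap v (update μ k 0 η)) (p t) :=
      fun v => ((isLocal_gap v).comp_update μ k 0).integrable _
    have a : ∀ v, Integrable (fun η => gap v η + μ * gap 0 η) (p t) := fun v => (i v).add i'
    have b : ∀ v, Integrable (fun η => gap v η + μ * gap 0 η - gap v (update μ k 0 η)) (p t) :=
      fun v => (a v).sub (j v)
    simp only [loss, zero_sub, zero_add]
    rw [integral_add (b (-1)) (b 1), integral_sub (a (-1)) (j (-1)), integral_sub (a 1) (j 1),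
      integral_add (i (-1)) i', integral_add (i 1) i', integral_const_mul,
      integral_gap hp h0 (-1) ht, integral_gap hp h0 1 ht]
    ring
  have hself : ∀ k, ∫ η, gap 0 (update μ k 0 η) ∂p t = (1 - 2 * μ) * ∫ η, gap 0 η ∂p t := by
    intro k
    simp only [gap_update_self hμ hμ', integral_const_mul]
  have hfar : ∀ k, ∫ η, gap 2 (update μ k 0 η) ∂p t = ∫ η, gap 0 η ∂p t := by
    intro k
    rw [← integral_gap hp h0 2 ht]
    exact integral_congr_ae (Eventually.of_forall fun η =>
      gap_update_of_ne η (by norm_num) (by norm_num) (by norm_num))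
  rw [integral_generator μ (isLocal_gap 0) hn hE]
  simp only [hmean, Finset.sum_const, hloss]
  rw [Finset.sum_insert (by decide), Finset.sum_insert (by decide), Finset.sum_insert (by decide),
    Finset.sum_singleton, show (({-2, -1, 0, 1} : Finset ℤ)).card = 4 by decide]
  simp only [neg_neg, neg_zero, hself, hfar]
  rw [nsmul_eq_mul]
  push_cast
  ring

theorem integral_gap_antitone (hp : IsForwardSolution μ p) (hμ : 0 ≤ μ) (hμ' : μ ≤ 1 / 2)
    (h0 : ∀ z, (p 0).map (shift z) = p 0) {r t : ℝ} (hr : 0 ≤ r) (hrt : r ≤ t) :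
    ∫ η, gap 0 η ∂p t ≤ ∫ η, gap 0 η ∂p r := by
  have h := (hp.comp_add hr).forward (gap 0) (isLocal_gap 0) (t - r) (sub_nonneg.2 hrt)
  have h1 : 0 ≤ ∫ s in (0 : ℝ)..(t - r), -∫ η, generator μ (gap 0) η ∂p (s + r) := by
    refine intervalIntegral.integral_nonneg (sub_nonneg.2 hrt) fun s hs => ?_
    rw [integral_generator_gap hp hμ hμ' h0 (add_nonneg hs.1 hr), neg_neg]
    exact mul_nonneg (by norm_num) (add_nonneg (integral_nonneg (loss_nonneg hμ _ _))
      (integral_nonneg (loss_nonneg hμ _ _)))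
  rw [intervalIntegral.integral_neg] at h1
  simp only [sub_add_cancel, zero_add] at h
  linarith

theorem negligible_loss (hp : IsForwardSolution μ p) (hμ : 0 ≤ μ) (hμ' : μ ≤ 1 / 2)
    (h0 : ∀ z, (p 0).map (shift z) = p 0) (u : ℤ) : Negligible p (loss μ true u) := by
  have h : Negligible p (loss μ true 0) := by
    -- The bound `2`: half of the accumulated loss is paid for by the initial expected gap, which is
    -- at most `1`.
    refine ⟨isLocal_loss μ true 0, loss_nonneg hμ _ _, 2, fun t ht => ?_⟩
    have h1 := hp.forward (gap 0) (isLocal_gap 0) t ht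
    have h2 : ∫ s in (0 : ℝ)..t, ∫ η, generator μ (gap 0) η ∂p s ≤
        ∫ s in (0 : ℝ)..t, -(1 / 2) * ∫ η, loss μ true 0 η ∂p s := by
      refine intervalIntegral.integral_mono_on ht
        (hp.intervalIntegrable ((isLocal_gap 0).generator μ) _ _)
        ((hp.intervalIntegrable (isLocal_loss μ true 0) _ _).const_mul _) fun s hs => ?_
      rw [integral_generator_gap hp hμ hμ' h0 hs.1]
      have : 0 ≤ ∫ η, loss μ false 0 η ∂p s := integral_nonneg (loss_nonneg hμ _ _)
      linarith
    rw [intervalIntegral.integral_const_mul] at h2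
    have h3 : 0 ≤ ∫ η, gap 0 η ∂p t := integral_nonneg (gap_nonneg 0)
    have h4 := (abs_le.1 (hp.abs_integral_le (f := gap 0) (M := 1)
      (fun η => abs_le.2 ⟨by linarith [gap_nonneg 0 η], gap_le_one 0 η⟩) 0)).2
    linarith
  simpa only [loss_shift, zero_add] using h.comp_shift hp (h0 u)

end

/-! ### Weights -/

/-- The discrete Laplacian. -/
def laplacian (q : ℤ → ℝ) (u : ℤ) : ℝ := q (u - 1) + q (u + 1) - 2 * q u

/-- The weights that arise from the point mass at `0` by finitely many relaxation steps at
vertices other than `0`. -/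
inductive Reachable (μ : ℝ) : (ℤ →₀ ℝ) → Prop
  | single : Reachable μ (Finsupp.single 0 1)
  | step (q : ℤ →₀ ℝ) (u : ℤ) (hq : Reachable μ q) (hu : u ≠ 0) :
      Reachable μ (q + Finsupp.single u (μ * laplacian q u))

theorem Reachable.mem_Icc {μ : ℝ} (hμ : 0 ≤ μ) (hμ' : μ ≤ 1 / 2) {q : ℤ →₀ ℝ}
    (hq : Reachable μ q) (v : ℤ) : q v ∈ Set.Icc (0 : ℝ) 1 := by
  induction hq generalizing v with
  | single =>
    rw [Finsupp.single_apply]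
    split_ifs <;> simp
  | step q u _ _ ih =>
    rw [Finsupp.add_apply, Finsupp.single_apply]
    split_ifs with h
    · subst h
      obtain ⟨h1, h1'⟩ := ih (u - 1)
      obtain ⟨h2, h2'⟩ := ih (u + 1)
      obtain ⟨h3, h3'⟩ := ih u
      unfold laplacian
      constructor <;> nlinarith
    · simpa using ih v

theorem Reachable.apply_zero {μ : ℝ} {q : ℤ →₀ ℝ} (hq : Reachable μ q) : q 0 = 1 := by
  induction hq with
  | single => simp
  | step q u _ hu ih => simp [ih, hu]

/-- The total mass of weights. -/
def mass (q : ℤ →₀ ℝ) : ℝ := Finsupp.linearCombination ℝ (fun _ => (1 : ℝ)) q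

theorem mass_add_single (q : ℤ →₀ ℝ) (u : ℤ) (c : ℝ) :
    mass (q + Finsupp.single u c) = mass q + c := by
  simp [mass]

theorem sum_le_mass {q : ℤ →₀ ℝ} (hq : ∀ v, 0 ≤ q v) (s : Finset ℤ) :
    ∑ v ∈ s, q v ≤ mass q := by
  classical
  have : mass q = ∑ v ∈ q.support ∪ s, q v := by
    rw [mass, Finsupp.linearCombination_apply, Finsupp.sum_of_support_subset (s := q.support ∪ s) _
      Finset.subset_union_left _ (by simp)]
    simp
  rw [this]
  exact Finset.sum_le_sum_of_subset_of_nonneg Finset.subset_union_right fun v _ _ => hq v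

/-- An almost concave sequence in `[0, 1]` that starts at `1` decreases slowly. -/
theorem half_le_of_almost_concave {a : ℕ → ℝ} (ha : ∀ j, a j ∈ Set.Icc (0 : ℝ) 1)
    (ha0 : a 0 = 1) {m : ℕ} (hm : 0 < m)
    (hc : ∀ j, a j + a (j + 2) - 2 * a (j + 1) ≤ 1 / (4 * m) ^ 2) {j : ℕ} (hj : j ≤ m) :
    1 / 2 ≤ a j := by
  have hm' : (0 : ℝ) < m := by exact_mod_cast hm
  set ε : ℝ := 1 / (4 * m) ^ 2 with hε
  have hε0 : 0 ≤ ε := by positivity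
  have hslope : ∀ j i : ℕ, a (j + i + 1) - a (j + i) ≤ a (j + 1) - a j + i * ε := by
    intro j i
    induction i with
    | zero => simp
    | succ i ih =>
      have := hc (j + i)
      push_cast
      rw [show j + (i + 1) + 1 = j + i + 2 by ring, show j + (i + 1) = j + i + 1 by ring]
      linarith
  have hup : ∀ j i : ℕ, a (j + i) ≤ a j + i * (a (j + 1) - a j) + i ^ 2 * ε := by
    intro j i
    induction i with
    | zero => simp
    | succ i ih =>
      have := hslope j i
      push_cast
      rw [← add_assoc]
      nlinarith [mul_nonneg (Nat.cast_nonneg i : (0 : ℝ) ≤ i) hε0]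
  -- Over `4 * m` steps the accumulated curvature is at most `(4 * m) ^ 2 * ε = 1`, so a slope below
  -- `-1 / (2 * m)` would push the sequence below `0`.
  have hdown : ∀ j, a j - 1 / (2 * m) ≤ a (j + 1) := by
    intro j
    have h1 := hup j (4 * m)
    have h2 := (ha (j + 4 * m)).1
    have h3 := (ha j).2
    have h4 : ((4 * m : ℕ) : ℝ) ^ 2 * ε = 1 := by
      rw [hε]
      push_cast
      field_simp
    rw [h4] at h1
    push_cast at h1
    have h5 : -(1 / (2 * m : ℝ)) ≤ a (j + 1) - a j := by
      rw [neg_le, ← sub_nonneg]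
      have : 1 / (2 * m : ℝ) - -(a (j + 1) - a j) =
        (2 + 4 * m * (a (j + 1) - a j)) / (4 * m) := by field_simp; ring
      rw [this]
      apply div_nonneg <;> linarith
    linarith
  have hlin : ∀ j : ℕ, 1 - j * (1 / (2 * m)) ≤ a j := by
    intro j
    induction j with
    | zero => simp [ha0]
    | succ j ih =>
      have := hdown j
      push_cast
      linarith
  refine le_trans ?_ (hlin j)
  have : (j : ℝ) * (1 / (2 * m)) ≤ m * (1 / (2 * m)) := by gcongr
  have h' : (m : ℝ) * (1 / (2 * m)) = 1 / 2 := by field_simp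
  linarith

/-- If the masses were bounded, take one within `μ * ε` of the supremum. A further relaxation at `u`
adds `μ * laplacian q u`, so the Laplacian is at most `ε` off `0`. The weights are then almost
concave to the right of `0` and stay above `1 / 2` long enough to exceed `S`. -/
theorem exists_reachable_mass_gt {μ : ℝ} (hμ : 0 < μ) (hμ' : μ ≤ 1 / 2) (S : ℝ) :
    ∃ q, Reachable μ q ∧ S < mass q := by
  by_contra! hS
  set A : Set ℝ := mass '' {q | Reachable μ q} with hA
  have hne : A.Nonempty := ⟨_, _, Reachable.single, rfl⟩
  have hbdd : BddAbove A := ⟨S, by rintro _ ⟨q, hq, rfl⟩; exact hS q hq⟩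
  obtain ⟨m, hm⟩ := exists_nat_gt (2 * S)
  obtain ⟨n, hnm⟩ : ∃ n, n = m + 1 := ⟨_, rfl⟩
  have hn : (0 : ℝ) < n := by rw [hnm]; positivity
  set ε : ℝ := 1 / (4 * n) ^ 2 with hε
  have hε0 : 0 < ε := by positivity
  obtain ⟨_, ⟨q, hq, rfl⟩, hlt⟩ := exists_lt_of_lt_csSup hne
    (sub_lt_self (sSup A) (mul_pos hμ hε0))
  have hq : Reachable μ q := hq
  have hlap : ∀ u : ℤ, u ≠ 0 → laplacian q u ≤ ε := by
    intro u hu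
    have h1 : mass (q + Finsupp.single u (μ * laplacian q u)) ≤ sSup A :=
      le_csSup hbdd ⟨_, hq.step q u hu, rfl⟩
    rw [mass_add_single] at h1
    exact le_of_mul_le_mul_left (by linarith : μ * laplacian q u ≤ μ * ε) hμ
  have hhalf : ∀ j : ℕ, j ≤ n → 1 / 2 ≤ q j := fun j hj =>
    half_le_of_almost_concave (a := fun j : ℕ => q j) (fun j => hq.mem_Icc hμ.le hμ' j)
      hq.apply_zero (by omega) (fun j => by
        have := hlap (j + 1) (by omega)
        rw [laplacian, add_sub_cancel_right, add_assoc, one_add_one_eq_two] at this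
        push_cast
        exact this) hj
  have h1 := sum_le_mass (fun v => (hq.mem_Icc hμ.le hμ' v).1)
    ((Finset.range (n + 1)).map Nat.castEmbedding)
  rw [Finset.sum_map] at h1
  have h2 : ∑ j ∈ Finset.range (n + 1), (1 / 2 : ℝ) ≤
      ∑ j ∈ Finset.range (n + 1), q (Nat.castEmbedding j : ℤ) :=
    Finset.sum_le_sum fun j hj => hhalf j (Nat.lt_succ_iff.1 (Finset.mem_range.1 hj))
  rw [Finset.sum_const, Finset.card_range, nsmul_eq_mul] at h2
  have h3 := hS q hq
  have : ((n + 1 : ℕ) : ℝ) = m + 2 := by rw [hnm]; push_cast; ring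
  rw [this] at h2
  linarith

/-! ### Decay of the discrepancies -/

/-- The discrepancies, summed with weights. -/
def weightedGap (q : ℤ →₀ ℝ) (η : Config) : ℝ :=
  Finsupp.linearCombination ℝ (fun v => gap v η) q

theorem weightedGap_step_le {μ : ℝ} (hμ : 0 ≤ μ) (hμ' : μ ≤ 1 / 2) {q : ℤ →₀ ℝ}
    (hq : ∀ v, 0 ≤ q v) (u : ℤ) (η : Config) :
    weightedGap (q + Finsupp.single u (μ * laplacian q u)) η ≤
      weightedGap q (update μ true u η) + (q (u - 1) + q (u + 1)) * loss μ true u η := by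
  classical
  -- Summed against `q`, the indicators multiplying `μ * gap u η` produce `laplacian q u`. Each
  -- adjacent gap is charged the whole loss, which dominates its own defect.
  have hpt : ∀ v : ℤ, gap v η + μ * gap u η * ((if v = u - 1 then 1 else 0) +
      (if v = u + 1 then 1 else 0) - 2 * (if v = u then 1 else 0)) ≤
      gap v (update μ true u η) + ((if v = u - 1 then 1 else 0) + (if v = u + 1 then 1 else 0)) *
        loss μ true u η := by
    intro v
    have hl := gap_update_left_le hμ true u η
    have hr := gap_update_right_le hμ true u η
    rcases eq_or_ne v (u - 1) with rfl | h1
    · rw [if_pos rfl, if_neg (by omega), if_neg (by omega), loss]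
      linarith
    rcases eq_or_ne v (u + 1) with rfl | h2
    · rw [if_pos rfl, if_neg (by omega), if_neg (by omega), loss]
      linarith
    rcases eq_or_ne v u with rfl | h3
    · rw [if_pos rfl, if_neg (by omega), if_neg (by omega), gap_update_self hμ hμ']
      linarith
    · rw [if_neg h1, if_neg h2, if_neg h3, gap_update_of_ne η h1 h3 h2]
      linarith
  have hsum := Finset.sum_le_sum fun v (_ : v ∈ q.support) =>
    mul_le_mul_of_nonneg_left (hpt v) (hq v)
  have hdelta : ∀ w : ℤ, ∑ v ∈ q.support, q v * (if v = w then 1 else 0) = q w := by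
    intro w
    simp only [mul_ite, mul_one, mul_zero, Finset.sum_ite_eq', Finsupp.mem_support_iff]
    split_ifs with h
    · rfl
    · exact (not_not.1 h).symm
  have e1 : weightedGap (q + Finsupp.single u (μ * laplacian q u)) η =
      ∑ v ∈ q.support, q v * (gap v η + μ * gap u η * ((if v = u - 1 then 1 else 0) +
      (if v = u + 1 then 1 else 0) - 2 * (if v = u then 1 else 0))) := by
    rw [weightedGap, map_add, Finsupp.linearCombination_single, Finsupp.linearCombination_apply,
      Finsupp.sum]
    simp only [smul_eq_mul, laplacian]
    conv_lhs => rw [← hdelta (u - 1), ← hdelta (u + 1), ← hdelta u]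
    simp only [Finset.mul_sum, Finset.sum_mul, ← Finset.sum_add_distrib, ← Finset.sum_sub_distrib]
    exact Finset.sum_congr rfl fun v _ => by ring
  have e2 : weightedGap q (update μ true u η) + (q (u - 1) + q (u + 1)) * loss μ true u η =
      ∑ v ∈ q.support, q v * (gap v (update μ true u η) + ((if v = u - 1 then 1 else 0) +
        (if v = u + 1 then 1 else 0)) * loss μ true u η) := by
    rw [weightedGap, Finsupp.linearCombination_apply, Finsupp.sum]
    simp only [smul_eq_mul]
    conv_lhs => rw [← hdelta (u - 1), ← hdelta (u + 1)]
    simp only [Finset.sum_mul, ← Finset.sum_add_distrib]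
    exact Finset.sum_congr rfl fun v _ => by ring
  rw [e1, e2]
  exact hsum

section

variable {μ : ℝ} {p : ℝ → Measure Config}

/-- Apply the inductive bound to the updated configuration: the new error is the old one after an
update plus a multiple of the loss, both negligible. -/
theorem Reachable.exists_negligible (hp : IsForwardSolution μ p) (hμ : 0 ≤ μ) (hμ' : μ ≤ 1 / 2)
    (h0 : ∀ z, (p 0).map (shift z) = p 0) {q : ℤ →₀ ℝ} (hq : Reachable μ q) :
    ∃ g, Negligible p g ∧ ∀ η, weightedGap q η ≤ 1 + g η := by
  induction hq with
  | single =>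
    refine ⟨_, Negligible.zero, fun η => ?_⟩
    simpa [weightedGap] using gap_le_one 0 η
  | step q u hq _ ih =>
    obtain ⟨g, hg, hle⟩ := ih
    have hpos := fun v => (hq.mem_Icc hμ hμ' v).1
    refine ⟨_, (hg.comp_update hp u).add hp ((negligible_loss hp hμ hμ' h0 u).const_mul
      (add_nonneg (hpos (u - 1)) (hpos (u + 1)))), fun η => ?_⟩
    have h1 := weightedGap_step_le hμ hμ' hpos u η
    have h2 := hle (update μ true u η)
    linarith

theorem integral_weightedGap (hp : IsForwardSolution μ p) (h0 : ∀ z, (p 0).map (shift z) = p 0)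
    (q : ℤ →₀ ℝ) {t : ℝ} (ht : 0 ≤ t) :
    ∫ η, weightedGap q η ∂p t = mass q * ∫ η, gap 0 η ∂p t := by
  simp only [weightedGap, mass, Finsupp.linearCombination_apply, Finsupp.sum, smul_eq_mul]
  rw [integral_finsetSum _ fun v _ => (hp.integrable (isLocal_gap v) t).const_mul _,
    Finset.sum_mul]
  refine Finset.sum_congr rfl fun v _ => ?_
  rw [integral_const_mul, integral_gap hp h0 v ht, mul_one]

theorem isLocal_weightedGap (q : ℤ →₀ ℝ) : IsLocal (weightedGap q) := by
  have : weightedGap q = fun η => ∑ v ∈ q.support, q v * gap v η := by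
    funext η
    simp [weightedGap, Finsupp.linearCombination_apply, Finsupp.sum]
  rw [this]
  exact isLocal_sum _ fun v _ => (isLocal_gap v).const_mul _

/-- Weak consensus: the expected discrepancy of neighbours vanishes in the limit. -/
theorem tendsto_integral_gap (hp : IsForwardSolution μ p) (hμ : 0 < μ) (hμ' : μ ≤ 1 / 2)
    (h0 : ∀ z, (p 0).map (shift z) = p 0) :
    Tendsto (fun t => ∫ η, gap 0 η ∂p t) atTop (𝓝 0) := by
  have hnn : ∀ t, 0 ≤ ∫ η, gap 0 η ∂p t := fun t => integral_nonneg (gap_nonneg 0)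
  rw [Metric.tendsto_atTop]
  intro c hc
  -- The expected gap is nonincreasing, so one small value is enough.
  suffices h : ∃ r, 0 ≤ r ∧ ∫ η, gap 0 η ∂p r < c by
    obtain ⟨r, hr, hlt⟩ := h
    refine ⟨r, fun t ht => ?_⟩
    rw [Real.dist_eq, sub_zero, abs_of_nonneg (hnn t)]
    exact (integral_gap_antitone hp hμ.le hμ' h0 hr ht).trans_lt hlt
  by_contra! hge
  obtain ⟨q, hq, hmass⟩ := exists_reachable_mass_gt hμ hμ' (2 / c)
  obtain ⟨g, hg, hle⟩ := hq.exists_negligible hp hμ.le hμ' h0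
  obtain ⟨C, hC⟩ := hg.bounded
  have hone : ∀ t, 0 ≤ t → 1 ≤ ∫ η, g η ∂p t := by
    intro t ht
    have := hp.isProbabilityMeasure t
    have h1 : ∫ η, weightedGap q η ∂p t ≤ ∫ η, (1 + g η) ∂p t :=
      integral_mono ((isLocal_weightedGap q).integrable _)
        (((isLocal_const 1).add hg.isLocal).integrable _) hle
    rw [integral_weightedGap hp h0 q ht, integral_add (integrable_const _)
      (hg.isLocal.integrable _)] at h1
    have h2 : 2 / c * c ≤ mass q * ∫ η, gap 0 η ∂p t :=
      mul_le_mul hmass.le (hge t ht) hc.le ((by positivity : 0 ≤ 2 / c).trans hmass.le)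
    rw [div_mul_cancel₀ _ hc.ne'] at h2
    simp at h1
    linarith
  -- By this time the integral of `E g ≥ 1` exceeds its bound `C`.
  have ht : 0 ≤ |C| + 1 := by positivity
  have h1 := intervalIntegral.integral_mono_on ht intervalIntegrable_const
    (hp.intervalIntegrable hg.isLocal 0 (|C| + 1)) fun s hs => hone s hs.1
  have h2 := hC _ ht
  simp at h1
  linarith [le_abs_self C]

end

/-! ### Convergence of the laws -/

theorem tendsto_integral_norm_sub {μ : ℝ} {p : ℝ → Measure Config} (hp : IsForwardSolution μ p)
    (hμ : 0 < μ) (hμ' : μ ≤ 1 / 2) (h0 : ∀ z, (p 0).map (shift z) = p 0) (v : ℤ) :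
    Tendsto (fun t => ∫ η, ‖η v - η 0‖ ∂p t) atTop (𝓝 0) := by
  have hgap := tendsto_integral_gap hp hμ hμ' h0
  have hstep : ∀ v w z : ℤ, (∀ η, ‖η w - η v‖ = gap z η) →
      Tendsto (fun t => ∫ η, ‖η v - η 0‖ ∂p t) atTop (𝓝 0) →
      Tendsto (fun t => ∫ η, ‖η w - η 0‖ ∂p t) atTop (𝓝 0) := by
    intro v w z hz hv
    have hsum := hv.add hgap
    rw [add_zero] at hsum
    refine tendsto_of_tendsto_of_tendsto_of_le_of_le' tendsto_const_nhds hsum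
      (Eventually.of_forall fun t => integral_nonneg fun η => norm_nonneg _) ?_
    filter_upwards [eventually_ge_atTop 0] with t ht
    rw [← integral_gap hp h0 z ht, ← integral_add (hp.integrable (isLocal_norm_sub v 0) t)
      (hp.integrable (isLocal_gap z) t)]
    refine integral_mono (hp.integrable (isLocal_norm_sub w 0) t)
      (hp.integrable ((isLocal_norm_sub v 0).add (isLocal_gap z)) t) fun η => ?_
    simp only
    rw [← hz, add_comm, ← sub_add_sub_cancel (η w) (η v) (η 0)]
    exact norm_add_le _ _
  induction v using Int.induction_on with
  | zero => simp
  | succ i ih => exact hstep _ _ i (fun η => rfl) ih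
  | pred i ih =>
    refine hstep _ _ (-i - 1) (fun η => ?_) ih
    rw [gap, sub_add_cancel, norm_sub_rev]

/-- Average over the rotation `r` and swap the integrals: for fixed `η`, the point `η 0 + r` is
uniform. -/
theorem integral_comp_rotate_haar {μ : ℝ} {p : ℝ → Measure Config} (hp : IsForwardSolution μ p)
    (h0 : ∀ r, (p 0).map (rotate r) = p 0) {g : Opinion → ℝ} (hg : Measurable g) {M : ℝ}
    (hM : ∀ s, |g s| ≤ M) {t : ℝ} (ht : 0 ≤ t) :
    ∫ η, g (η 0) ∂p t = ∫ s, g s ∂(AddCircle.haarAddCircle : Measure Opinion) := by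
  have := hp.isProbabilityMeasure t
  have h0m : Measurable fun η : Config => η 0 := measurable_pi_apply 0
  have hl : IsLocal fun η => g (η 0) :=
    IsLocal.of_finset (hg.comp h0m) (fun η => hM _) {0} fun x y h => by
      simp only [h 0 (by simp)]
  have hr : ∀ r : Opinion, ∫ η, g (η 0 + r) ∂p t = ∫ η, g (η 0) ∂p t := fun r =>
    hp.integral_comp_rotate (h0 r) ht hl
  have hi : Integrable (Function.uncurry fun (r : Opinion) (η : Config) => g (η 0 + r))
      ((AddCircle.haarAddCircle : Measure Opinion).prod (p t)) :=
    Integrable.of_bound (hg.comp ((h0m.comp measurable_snd).add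
      measurable_fst)).aestronglyMeasurable M (Eventually.of_forall fun z => hM _)
  have hswap := integral_integral_swap hi
  simp only [hr, integral_const, probReal_univ, one_smul,
    integral_add_left_eq_self (μ := (AddCircle.haarAddCircle : Measure Opinion))] at hswap
  exact hswap

/-- Uniform continuity on the compact product, whose entourages constrain only finitely many
coordinates. -/
theorem exists_finset_of_continuous {f : Config → ℝ} (hf : Continuous f) {ε : ℝ} (hε : 0 < ε) :
    ∃ Λ : Finset ℤ, ∃ δ > 0, ∀ x y : Config, (∀ v ∈ Λ, ‖x v - y v‖ < δ) → |f x - f y| < ε := by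
  have hmem : {z : Config × Config | dist (f z.1) (f z.2) < ε} ∈ uniformity Config :=
    (CompactSpace.uniformContinuous_of_continuous hf) (Metric.dist_mem_uniformity hε)
  rw [Pi.uniformity, Filter.mem_iInf] at hmem
  obtain ⟨I, hI, V, hV, hVe⟩ := hmem
  have hδ : ∀ i : I, ∃ δ > 0, ∀ x y : Config, ‖x i - y i‖ < δ → (x, y) ∈ V i := by
    intro i
    obtain ⟨W, hW, hWV⟩ := Filter.mem_comap.1 (hV i)
    obtain ⟨δ, hδ, h⟩ := Metric.mem_uniformity_dist.1 hW
    exact ⟨δ, hδ, fun x y hxy => hWV (h (by rwa [dist_eq_norm]))⟩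
  choose δ hδ hδV using hδ
  have := hI.to_subtype
  obtain ⟨d, hd, hd0⟩ : ∃ d : ℝ, (∀ i, d ≤ δ i) ∧ 0 < d := by
    have h1 : ∀ᶠ d in 𝓝[>] (0 : ℝ), ∀ i, d ≤ δ i := eventually_all.2 fun i =>
      (eventually_le_nhds (hδ i)).filter_mono nhdsWithin_le_nhds
    exact (h1.and self_mem_nhdsWithin).exists
  refine ⟨hI.toFinset, d, hd0, fun x y h => ?_⟩
  have : (x, y) ∈ {z : Config × Config | dist (f z.1) (f z.2) < ε} := by
    rw [hVe]
    exact Set.mem_iInter.2 fun i => hδV i x y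
      ((h i (hI.mem_toFinset.2 i.2)).trans_le (hd i))
  exact this

theorem integral_constMixture (f : Config → ℝ) (hf : Measurable f) :
    ∫ η, f η ∂(constMixture : Measure Config) =
      ∫ s, f (constConfig s) ∂(AddCircle.haarAddCircle : Measure Opinion) := by
  have : (constMixture : Measure Config) =
      (AddCircle.haarAddCircle : Measure Opinion).map constConfig :=
    Measure.bind_dirac_eq_map _ measurable_constConfig
  rw [this, integral_map measurable_constConfig.aemeasurable hf.aestronglyMeasurable]

theorem tendsto_integral_of_isForwardSolution {μ : ℝ} {p : ℝ → Measure Config}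
    (hp : IsForwardSolution μ p) (hμ : 0 < μ) (hμ' : μ ≤ 1 / 2)
    (hshift : ∀ z, (p 0).map (shift z) = p 0) (hrotate : ∀ r, (p 0).map (rotate r) = p 0)
    {f : Config → ℝ} (hf : Continuous f) :
    Tendsto (fun t => ∫ η, f η ∂p t) atTop
      (𝓝 (∫ s, f (constConfig s) ∂(AddCircle.haarAddCircle : Measure Opinion))) := by
  obtain ⟨M, hM⟩ := isCompact_univ.exists_bound_of_continuousOn hf.continuousOn
  replace hM : ∀ η, |f η| ≤ M := fun η => hM η (Set.mem_univ η)
  have hcm : Measurable fun s => f (constConfig s) := hf.measurable.comp measurable_constConfig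
  rw [Metric.tendsto_atTop]
  intro ε hε
  obtain ⟨Λ, δ, hδ, hΛ⟩ := exists_finset_of_continuous hf (half_pos hε)
  have hM0 : 0 ≤ M := (abs_nonneg _).trans (hM fun _ => 0)
  -- Either all distances are below `δ`, or their sum is at least `δ` and the second term alone
  -- covers the trivial bound `2 * M`.
  have hpt : ∀ η : Config, |f η - f (constConfig (η 0))| ≤
      ε / 2 + 2 * M / δ * ∑ v ∈ Λ, ‖η v - η 0‖ := by
    intro η
    have hs : 0 ≤ ∑ v ∈ Λ, ‖η v - η 0‖ := Finset.sum_nonneg fun v _ => norm_nonneg _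
    by_cases h : ∀ v ∈ Λ, ‖η v - η 0‖ < δ
    · have h1 := hΛ η (constConfig (η 0)) h
      have h2 : 0 ≤ 2 * M / δ * ∑ v ∈ Λ, ‖η v - η 0‖ := by positivity
      linarith
    · push Not at h
      obtain ⟨v, hv, hle⟩ := h
      have h1 : δ ≤ ∑ v ∈ Λ, ‖η v - η 0‖ :=
        hle.trans (Finset.single_le_sum (f := fun v => ‖η v - η 0‖) (fun _ _ => norm_nonneg _) hv)
      have h2 : 2 * M / δ * δ ≤ 2 * M / δ * ∑ v ∈ Λ, ‖η v - η 0‖ := by gcongr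
      rw [div_mul_cancel₀ _ hδ.ne'] at h2
      have h3 := abs_le.1 (hM η)
      have h4 := abs_le.1 (hM (constConfig (η 0)))
      rw [abs_le]
      constructor <;> linarith
  have hlim : Tendsto (fun t => 2 * M / δ * ∑ v ∈ Λ, ∫ η, ‖η v - η 0‖ ∂p t) atTop (𝓝 0) := by
    simpa using (tendsto_finsetSum Λ fun v _ =>
      tendsto_integral_norm_sub hp hμ hμ' hshift v).const_mul (2 * M / δ)
  obtain ⟨T, hT⟩ := eventually_atTop.1
    ((hlim.eventually_lt_const (half_pos hε)).and (eventually_ge_atTop 0))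
  refine ⟨T, fun t ht => ?_⟩
  obtain ⟨hlt, ht0⟩ := hT t ht
  have := hp.isProbabilityMeasure t
  have hi : Integrable f (p t) :=
    Integrable.of_bound hf.measurable.aestronglyMeasurable M (Eventually.of_forall hM)
  have hi' : Integrable (fun η => f (constConfig (η 0))) (p t) :=
    Integrable.of_bound (hcm.comp (measurable_pi_apply 0)).aestronglyMeasurable M
      (Eventually.of_forall fun η => hM _)
  rw [← integral_comp_rotate_haar hp hrotate hcm (fun s => hM _) ht0, Real.dist_eq,
    ← integral_sub hi hi']
  have hl : IsLocal fun η => 2 * M / δ * ∑ v ∈ Λ, ‖η v - η 0‖ :=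
    (isLocal_sum Λ fun v _ => isLocal_norm_sub v 0).const_mul _
  have h1 := norm_integral_le_of_norm_le (f := fun η => f η - f (constConfig (η 0)))
    (hp.integrable ((isLocal_const (ε / 2)).add hl) t)
    (Eventually.of_forall hpt)
  rw [integral_add (integrable_const _) (hp.integrable hl t), integral_const_mul,
    integral_finsetSum _ fun v _ => hp.integrable (isLocal_norm_sub v 0) t] at h1
  simp only [integral_const, probReal_univ, one_smul, Real.norm_eq_abs] at h1
  linarith

end CompassModel

end

theorem corollary3 (μ : ℝ) (hμ_pos : 0 < μ) (hμ_le : μ ≤ 1 / 2)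
    {Ω : Type*} {mΩ : MeasurableSpace Ω} (P : Measure Ω) [IsProbabilityMeasure P]
    (ℱ : Filtration ℝ≥0 mΩ) (η : ℝ≥0 → Ω → CompassModel.Config)
    (hη : CompassModel.IsCompassModel μ P ℱ η) (h_init : CompassModel.IsIIDUniform P (η 0)) :
    Tendsto (fun t : ℝ≥0 => CompassModel.lawAt hη t) atTop (𝓝 CompassModel.constMixture) := by
  rw [ProbabilityMeasure.tendsto_iff_forall_integral_tendsto]
  intro f
  rw [CompassModel.integral_constMixture f f.continuous.measurable]
  have hzero : CompassModel.pathLaw P η 0 = P.map (η 0) := by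
    rw [CompassModel.pathLaw, Real.toNNReal_zero]
  have h := (CompassModel.tendsto_integral_of_isForwardSolution hη.isForwardSolution hμ_pos hμ_le
    (fun z => by rw [hzero]; exact h_init.map_shift (hη.measurable 0) z)
    (fun r => by rw [hzero]; exact h_init.map_rotate (hη.measurable 0) r)
    f.continuous).comp (NNReal.tendsto_coe_atTop.2 tendsto_id)
  refine h.congr fun t => ?_
  simp only [Function.comp_apply, CompassModel.pathLaw, id, Real.toNNReal_coe]
  rfl
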